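/- A graph $H$ is a comparability graph if its vertices have an ordering $v_1,\dots,v_n$ such that, for all $p<q<r$, if $v_pv_q$ and $v_qv_r$ are edges of $H$ then so is $v_pv_r$; a graph $G$ is a co-comparability graph if its complement is a comparability graph. An instance $(G,L)$ of the list coloring problem with $s$ colors in total consists of a graph $G$ with $n\ge 1$ vertices, a set $S$ of $s$ colors and a list $L(v)\subseteq S$ for each vertex $v$. To solve it means to decide whether there is a proper coloring $c\colon V(G)\to S$ with $c(v)\in L(v)$ for all $v$, and to output such a coloring if there is one. There is one algorithm that, given any instance $(G,L)$ in which $G$ is a co-comparability graph and $s\ge 2$ (given by $n$, $s$, the adjacency matrix of $G$ and the $n\times s$ incidence matrix of the lists; no ordering of the vertices is given), solves $(G,L)$ in time $\mathcal{O}(n^{s^2+1}s^3)$, with an absolute implied constant. In particular, for each fixed $s\ge 2$ it runs in time polynomial in $n$. Time is the number of steps on a word RAM (unit-cost addition, truncated subtraction, multiplication, integer division and remainder, tests for zero, indirect loads and stores) on which every number that occurs is at most the stated time bound, i.e. words have only logarithmically many bits in that bound. -/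

import Mathlib

/-! ### Comparability graphs -/

/-- `v` enumerates the vertices so that `v p v q` and `v q v r` being edges with `p < q < r` forces
`v p v r` to be an edge. -/
def IsComparabilityOrdering {V : Type*} (G : SimpleGraph V) {n : ℕ} (v : Fin n ≃ V) : Prop :=
  ∀ p q r : Fin n, p < q → q < r → G.Adj (v p) (v q) → G.Adj (v q) (v r) → G.Adj (v p) (v r)

/-- A (finite) graph is a comparability graph if it has a comparability ordering. -/
def IsComparabilityGraph {V : Type*} (G : SimpleGraph V) : Prop :=
  ∃ (n : ℕ) (v : Fin n ≃ V), IsComparabilityOrdering G v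

/-- A co-comparability graph is the complement of a comparability graph. -/
def IsCoComparabilityGraph {V : Type*} (G : SimpleGraph V) : Prop :=
  IsComparabilityGraph Gᶜ

/-- A list coloring: a proper coloring that gives each vertex a color from its list. -/
def IsListColoring {V S : Type*} (G : SimpleGraph V) (L : V → Finset S) (c : G.Coloring S) : Prop :=
  ∀ v, c v ∈ L v

/-! ### Word RAM -/

namespace RAM

/-- The arithmetic operations on natural numbers: `sub` is truncated subtraction, `div` and `mod`
are quotient and remainder of integer division (`a / 0 = 0`, `a % 0 = a`). -/
inductive Op
  | add | sub | mul | div | mod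

/-- Result of an arithmetic operation. -/
def Op.eval : Op → ℕ → ℕ → ℕ
  | .add, a, b => a + b
  | .sub, a, b => a - b
  | .mul, a, b => a * b
  | .div, a, b => a / b
  | .mod, a, b => a % b

/-- Programs, in structured form. The numbers `x y z` name registers. A program is a finite object,
so it uses a fixed finite number of registers; the unbounded memory is reached only through
`load` and `store`. -/
inductive Prog
  /-- do nothing -/
  | skip
  /-- `x := k` for a number `k` written in the program -/
  | const (x k : ℕ)
  /-- `x := y` -/
  | copy (x y : ℕ)
  /-- `x := y ∘ z` for an arithmetic operation `∘` -/
  | op (o : Op) (x y z : ℕ)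
  /-- `x := mem[y]` -/
  | load (x y : ℕ)
  /-- `mem[x] := y` -/
  | store (x y : ℕ)
  /-- first `P`, then `Q` -/
  | seq (P Q : Prog)
  /-- if `x ≠ 0` then `P` else `Q` -/
  | branch (x : ℕ) (P Q : Prog)
  /-- while `x ≠ 0` do `P` -/
  | loop (x : ℕ) (P : Prog)

/-- Machine states: contents of the registers and of the memory cells. -/
structure State where
  reg : ℕ → ℕ
  mem : ℕ → ℕ

/-- Assignment to a register. -/
def State.setReg (σ : State) (x a : ℕ) : State :=
  { σ with reg := Function.update σ.reg x a }

/-- Assignment to a memory cell. -/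
def State.setMem (σ : State) (i a : ℕ) : State :=
  { σ with mem := Function.update σ.mem i a }

/-- `Exec W P σ t σ'`: on a machine whose words hold the numbers `0, …, W`, the program `P` started
in `σ` halts in `σ'` after exactly `t` steps. Each elementary instruction and each test of a
register costs one step. An instruction whose result exceeds `W` is never executed: the machine
is stuck and the run does not halt. -/
inductive Exec (W : ℕ) : Prog → State → ℕ → State → Prop
  | skip (σ : State) : Exec W .skip σ 1 σ
  | const (σ : State) (x k : ℕ) (h : k ≤ W) : Exec W (.const x k) σ 1 (σ.setReg x k)
  | copy (σ : State) (x y : ℕ) : Exec W (.copy x y) σ 1 (σ.setReg x (σ.reg y))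
  | op (σ : State) (o : Op) (x y z : ℕ) (h : o.eval (σ.reg y) (σ.reg z) ≤ W) :
      Exec W (.op o x y z) σ 1 (σ.setReg x (o.eval (σ.reg y) (σ.reg z)))
  | load (σ : State) (x y : ℕ) : Exec W (.load x y) σ 1 (σ.setReg x (σ.mem (σ.reg y)))
  | store (σ : State) (x y : ℕ) : Exec W (.store x y) σ 1 (σ.setMem (σ.reg x) (σ.reg y))
  | seq {P Q : Prog} {σ₁ σ₂ σ₃ : State} {t u : ℕ}
      (hP : Exec W P σ₁ t σ₂) (hQ : Exec W Q σ₂ u σ₃) : Exec W (.seq P Q) σ₁ (t + u) σ₃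
  | branch_true {x : ℕ} {P Q : Prog} {σ σ' : State} {t : ℕ}
      (hx : σ.reg x ≠ 0) (h : Exec W P σ t σ') : Exec W (.branch x P Q) σ (t + 1) σ'
  | branch_false {x : ℕ} {P Q : Prog} {σ σ' : State} {t : ℕ}
      (hx : σ.reg x = 0) (h : Exec W Q σ t σ') : Exec W (.branch x P Q) σ (t + 1) σ'
  | loop_stop {x : ℕ} {P : Prog} {σ : State}
      (hx : σ.reg x = 0) : Exec W (.loop x P) σ 1 σ
  | loop_step {x : ℕ} {P : Prog} {σ₁ σ₂ σ₃ : State} {t u : ℕ}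
      (hx : σ₁.reg x ≠ 0) (hP : Exec W P σ₁ t σ₂) (hL : Exec W (.loop x P) σ₂ u σ₃) :
      Exec W (.loop x P) σ₁ (t + u + 1) σ₃

end RAM

/-! ### The list coloring problem on the word RAM -/

open Classical in
/-- Input `(G, L)` with vertices `0, …, n - 1` and colors `0, …, s - 1`. The memory holds `n`, then
`s`, then the `n × n` adjacency matrix row by row, then the `n × s` incidence matrix of the lists
row by row; all other cells and all registers are `0`. -/
noncomputable def listColoringInput {n s : ℕ} (G : SimpleGraph (Fin n))
    (L : Fin n → Finset (Fin s)) : RAM.State where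
  reg := fun _ => 0
  mem := fun a =>
    if a = 0 then n
    else if a = 1 then s
    else if ∃ u v : Fin n, a = 2 + u * n + v ∧ G.Adj u v then 1
    else if ∃ (v : Fin n) (i : Fin s), a = 2 + n * n + v * s + i ∧ i ∈ L v then 1
    else 0

/-- Correct final states: register `0` tells whether a list coloring exists, and if so, then the
memory cells `0, …, n - 1` hold the colors of the vertices in a list coloring. -/
def IsListColoringAnswer {n s : ℕ} (G : SimpleGraph (Fin n)) (L : Fin n → Finset (Fin s))
    (σ : RAM.State) : Prop :=
  (σ.reg 0 = 0 ∧ ¬ ∃ c : G.Coloring (Fin s), IsListColoring G L c) ∨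
  (σ.reg 0 = 1 ∧ ∃ c : G.Coloring (Fin s), IsListColoring G L c ∧
    ∀ v : Fin n, σ.mem v = (c v : ℕ))

/-- The program `P` solves the instance `(G, L)` in at most `B` steps, on a machine whose words hold
the numbers up to `B`. -/
def SolvesListColoringWithin {n s : ℕ} (P : RAM.Prog) (B : ℕ) (G : SimpleGraph (Fin n))
    (L : Fin n → Finset (Fin s)) : Prop :=
  ∃ (t : ℕ) (σ : RAM.State), RAM.Exec B P (listColoringInput G L) t σ ∧ t ≤ B ∧
    IsListColoringAnswer G L σ

/-! The algorithm first finds an ordering and then runs a dynamic program along it.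

In a transitive orientation of `Gᶜ`, two non-edges `uv` and `uw` of `G` with `vw` an edge both leave
`u` or both enter it. Hence the classes of ordered pairs under this forcing relation are oriented as
a whole, and in a co-comparability graph no class contains a pair together with its reverse
(`not_forcing_reachable_swap`). Of each class and its reverse, the one with the lexicographically
smaller least pair is chosen. By the triangle lemma (`forcing_triangle`) this choice admits no
directed triangle, so it is transitive (`LexDir.trans`), and sorting the vertices by in-degree
yields a comparability ordering of `Gᶜ`. The least pairs come from `n * n` rounds of relaxation over
all triples of vertices, in O(n^5) steps.

Along such an ordering non-adjacency is transitive in the forward direction. So a vertex may join a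
color class as soon as it is not adjacent to the last vertex of that class (`PartialColoring.step`),
and the positions of the `s` last vertices are all that a partial coloring needs to remember. The
table has `n + 1` layers of `n ^ s` states with at most `s` colors to try in each, which takes
O(n^(s+1) s) steps. For `s ≥ 2` both costs are within the stated bound.

The program is written in a small language of named variables and arrays. `Runs` is a Hoare triple
for total correctness with a time bound; `Expr.Ok` records that no intermediate value exceeds the
word size. -/

namespace RAM

/-! ### Abstract stores and expressions -/

/-- The variables of the list coloring program. Variable `x` lives in register `2 * x.idx`. -/
inductive Var
  | ans | n | s | sq | pw | r | i | j | k | acc | t | st | c | q | d | hit | col | next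

def Var.idx : Var → ℕ
  | ans => 0 | n => 1 | s => 2 | sq => 3 | pw => 4 | r => 5 | i => 6 | j => 7 | k => 8 | acc => 9
  | t => 10 | st => 11 | c => 12 | q => 13 | d => 14 | hit => 15 | col => 16 | next => 17

theorem Var.idx_injective : Function.Injective Var.idx := by
  intro a b h
  cases a <;> cases b <;> first | rfl | cases h

instance : DecidableEq Var := fun a b =>
  decidable_of_iff (a.idx = b.idx) Var.idx_injective.eq_iff

/-- The arrays of the list coloring program. They are interleaved in the memory behind the input. -/
inductive Arr
  | lab | deg | ord | tab | out

def Arr.idx : Arr → ℕ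
  | lab => 0 | deg => 1 | ord => 2 | tab => 3 | out => 4

theorem Arr.idx_injective : Function.Injective Arr.idx := by
  intro a b h
  cases a <;> cases b <;> first | rfl | cases h

theorem Arr.idx_lt (a : Arr) : a.idx < 8 := by cases a <;> simp [Arr.idx]

instance : DecidableEq Arr := fun a b =>
  decidable_of_iff (a.idx = b.idx) Arr.idx_injective.eq_iff

/-- Abstract machine states: variables, arrays, and the memory region of the input. -/
@[ext] structure Store where
  var : Var → ℕ
  arr : Arr → ℕ → ℕ
  inp : ℕ → ℕ

def Store.set (h : Store) (x : Var) (a : ℕ) : Store :=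
  { h with var := fun y => if y = x then a else h.var y }

def Store.setArr (h : Store) (a : Arr) (i v : ℕ) : Store :=
  { h with arr := fun b j => if b = a ∧ j = i then v else h.arr b j }

def Store.setInp (h : Store) (i v : ℕ) : Store :=
  { h with inp := fun j => if j = i then v else h.inp j }

@[simp] theorem Store.set_var (h : Store) (x y : Var) (a : ℕ) :
    (h.set x a).var y = if y = x then a else h.var y := rfl
@[simp] theorem Store.set_arr (h : Store) (x : Var) (a : ℕ) : (h.set x a).arr = h.arr := rfl
@[simp] theorem Store.set_inp (h : Store) (x : Var) (a : ℕ) : (h.set x a).inp = h.inp := rfl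
@[simp] theorem Store.setArr_var (h : Store) (a : Arr) (i v : ℕ) :
    (h.setArr a i v).var = h.var := rfl
@[simp] theorem Store.setArr_arr (h : Store) (a b : Arr) (i j v : ℕ) :
    (h.setArr a i v).arr b j = if b = a ∧ j = i then v else h.arr b j := rfl
@[simp] theorem Store.setArr_inp (h : Store) (a : Arr) (i v : ℕ) :
    (h.setArr a i v).inp = h.inp := rfl
@[simp] theorem Store.setInp_var (h : Store) (i v : ℕ) : (h.setInp i v).var = h.var := rfl
@[simp] theorem Store.setInp_arr (h : Store) (i v : ℕ) : (h.setInp i v).arr = h.arr := rfl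
@[simp] theorem Store.setInp_inp (h : Store) (i j v : ℕ) :
    (h.setInp i v).inp j = if j = i then v else h.inp j := rfl

theorem Store.setArr_arr_of_ne (h : Store) {a b : Arr} (i v : ℕ) (hab : b ≠ a) :
    (h.setArr a i v).arr b = h.arr b := by
  funext j; simp [hab]

/-- Expressions over variables and memory. -/
inductive Expr
  | var (x : Var)
  | const (k : ℕ)
  | op (o : Op) (a b : Expr)
  | arr (a : Arr) (e : Expr)
  | inp (e : Expr)

namespace Expr

instance : Coe Var Expr := ⟨Expr.var⟩
instance (k : ℕ) : OfNat Expr k := ⟨Expr.const k⟩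
instance : Add Expr := ⟨Expr.op .add⟩
instance : Sub Expr := ⟨Expr.op .sub⟩
instance : Mul Expr := ⟨Expr.op .mul⟩
instance : Div Expr := ⟨Expr.op .div⟩
instance : Mod Expr := ⟨Expr.op .mod⟩

def eval (h : Store) : Expr → ℕ
  | var x => h.var x
  | const k => k
  | op o a b => o.eval (a.eval h) (b.eval h)
  | arr a e => h.arr a (e.eval h)
  | inp e => h.inp (e.eval h)

/-- The evaluation of the expression stays within words of size `W`, where `β` is the size of the
input. -/
def Ok (W β : ℕ) (h : Store) : Expr → Prop
  | var _ => True
  | const k => k ≤ W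
  | op o a b => a.Ok W β h ∧ b.Ok W β h ∧ o.eval (a.eval h) (b.eval h) ≤ W
  | arr _ e => e.Ok W β h ∧ β + 8 * e.eval h + 8 ≤ W
  | inp e => e.Ok W β h ∧ e.eval h < β

def cost : Expr → ℕ
  | var _ => 1
  | const _ => 1
  | op _ a b => a.cost + b.cost + 1
  | arr _ e => e.cost + 6
  | inp e => e.cost + 1

section simp
variable (h : Store) (W β : ℕ) (x : Var) (a b : Expr) (y : Arr)
@[simp] theorem eval_var : (var x).eval h = h.var x := rfl
@[simp] theorem eval_zero : (0 : Expr).eval h = 0 := rfl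
@[simp] theorem eval_one : (1 : Expr).eval h = 1 := rfl
@[simp] theorem eval_two : (2 : Expr).eval h = 2 := rfl
@[simp] theorem eval_add : (a + b).eval h = a.eval h + b.eval h := rfl
@[simp] theorem eval_sub : (a - b).eval h = a.eval h - b.eval h := rfl
@[simp] theorem eval_mul : (a * b).eval h = a.eval h * b.eval h := rfl
@[simp] theorem eval_div : (a / b).eval h = a.eval h / b.eval h := rfl
@[simp] theorem eval_mod : (a % b).eval h = a.eval h % b.eval h := rfl
@[simp] theorem eval_arr : (arr y a).eval h = h.arr y (a.eval h) := rfl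
@[simp] theorem eval_inp : (inp a).eval h = h.inp (a.eval h) := rfl
@[simp] theorem ok_var : (var x).Ok W β h ↔ True := Iff.rfl
@[simp] theorem ok_zero : (0 : Expr).Ok W β h ↔ 0 ≤ W := Iff.rfl
@[simp] theorem ok_one : (1 : Expr).Ok W β h ↔ 1 ≤ W := Iff.rfl
@[simp] theorem ok_two : (2 : Expr).Ok W β h ↔ 2 ≤ W := Iff.rfl
@[simp] theorem ok_add :
    (a + b).Ok W β h ↔ a.Ok W β h ∧ b.Ok W β h ∧ a.eval h + b.eval h ≤ W := Iff.rfl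
@[simp] theorem ok_sub :
    (a - b).Ok W β h ↔ a.Ok W β h ∧ b.Ok W β h ∧ a.eval h - b.eval h ≤ W := Iff.rfl
@[simp] theorem ok_mul :
    (a * b).Ok W β h ↔ a.Ok W β h ∧ b.Ok W β h ∧ a.eval h * b.eval h ≤ W := Iff.rfl
@[simp] theorem ok_div :
    (a / b).Ok W β h ↔ a.Ok W β h ∧ b.Ok W β h ∧ a.eval h / b.eval h ≤ W := Iff.rfl
@[simp] theorem ok_mod :
    (a % b).Ok W β h ↔ a.Ok W β h ∧ b.Ok W β h ∧ a.eval h % b.eval h ≤ W := Iff.rfl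
@[simp] theorem ok_arr : (arr y a).Ok W β h ↔ a.Ok W β h ∧ β + 8 * a.eval h + 8 ≤ W := Iff.rfl
@[simp] theorem ok_inp : (inp a).Ok W β h ↔ a.Ok W β h ∧ a.eval h < β := Iff.rfl
end simp

end Expr

/-! ### Compilation of expressions to register code -/

/-- The registers that hold intermediate results. -/
def tmp (k : ℕ) : ℕ := 2 * k + 3

/-- Turn an array index in `tmp k` into an address. -/
def addrCode (a : Arr) (k : ℕ) : Prog :=
  .seq (.const (tmp (k + 1)) 8) <| .seq (.op .mul (tmp k) (tmp k) (tmp (k + 1))) <|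
  .seq (.const (tmp (k + 1)) a.idx) <| .seq (.op .add (tmp k) (tmp k) (tmp (k + 1))) <|
  .op .add (tmp k) (tmp k) 1

/-- Evaluate an expression into the register `tmp k`. -/
def Expr.code : Expr → ℕ → Prog
  | var x, k => .copy (tmp k) (2 * x.idx)
  | const c, k => .const (tmp k) c
  | op o a b, k => .seq (a.code k) (.seq (b.code (k + 1)) (.op o (tmp k) (tmp k) (tmp (k + 1))))
  | arr a e, k => .seq (e.code k) (.seq (addrCode a k) (.load (tmp k) (tmp k)))
  | inp e, k => .seq (e.code k) (.load (tmp k) (tmp k))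

/-- The machine state `σ` represents the abstract state `h`, for inputs of size `β`. -/
structure Rep (β : ℕ) (h : Store) (σ : State) : Prop where
  var : ∀ x : Var, σ.reg (2 * x.idx) = h.var x
  base : σ.reg 1 = β
  inp : ∀ i < β, σ.mem i = h.inp i
  arr : ∀ (a : Arr) (i : ℕ), σ.mem (β + 8 * i + a.idx) = h.arr a i

/-- Variables occupy the even registers, register `1` holds the base address, and temporaries are
the odd registers from `3` on. -/
theorem Rep.setTmp {β : ℕ} {h : Store} {σ : State} (H : Rep β h σ) (k v : ℕ) :
    Rep β h (σ.setReg (tmp k) v) where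
  var x := by
    have : 2 * x.idx ≠ tmp k := by unfold tmp; omega
    simp [State.setReg, Function.update_of_ne this, H.var]
  base := by
    have : 1 ≠ tmp k := by unfold tmp; omega
    simp [State.setReg, Function.update_of_ne this, H.base]
  inp := H.inp
  arr := H.arr

theorem Rep.set {β : ℕ} {h : Store} {σ : State} (H : Rep β h σ) (x : Var) (v : ℕ) :
    Rep β (h.set x v) (σ.setReg (2 * x.idx) v) where
  var y := by
    by_cases hxy : y = x
    · simp [State.setReg, hxy]
    · have : 2 * y.idx ≠ 2 * x.idx := fun h => hxy (Var.idx_injective (by omega))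
      simp [State.setReg, Function.update_of_ne this, hxy, H.var]
  base := by
    have : 1 ≠ 2 * x.idx := by omega
    simp [State.setReg, Function.update_of_ne this, H.base]
  inp := H.inp
  arr := H.arr

/-- Arrays share the memory behind the input with stride 8. Since `Arr.idx` is injective and below
8, the pair of array and index can be recovered from the address. -/
theorem Rep.setArr {β : ℕ} {h : Store} {σ : State} (H : Rep β h σ) (a : Arr) (i v : ℕ) :
    Rep β (h.setArr a i v) (σ.setMem (β + 8 * i + a.idx) v) where
  var := H.var
  base := H.base
  inp j hj := by
    have : j ≠ β + 8 * i + a.idx := by omega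
    simp [State.setMem, Function.update_of_ne this, H.inp j hj]
  arr b j := by
    have ha := a.idx_lt
    have hb := b.idx_lt
    by_cases hab : b = a ∧ j = i
    · simp [State.setMem, hab.1, hab.2]
    · have : β + 8 * j + b.idx ≠ β + 8 * i + a.idx := fun h =>
        hab ⟨Arr.idx_injective (by omega), by omega⟩
      simp [State.setMem, Function.update_of_ne this, hab, H.arr]

theorem Rep.setInp {β : ℕ} {h : Store} {σ : State} (H : Rep β h σ) {i : ℕ} (hi : i < β) (v : ℕ) :
    Rep β (h.setInp i v) (σ.setMem i v) where
  var := H.var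
  base := H.base
  inp j hj := by
    by_cases hij : j = i
    · simp [State.setMem, hij]
    · simp [State.setMem, hij, H.inp j hj]
  arr b j := by
    have : β + 8 * j + b.idx ≠ i := by omega
    simp [State.setMem, Function.update_of_ne this, H.arr]

theorem tmp_ne {j k : ℕ} (h : j ≠ k) : tmp j ≠ tmp k := by unfold tmp; omega

theorem exec_addrCode {W β : ℕ} {h : Store} {σ : State} (H : Rep β h σ) (a : Arr) (k : ℕ)
    (hW : β + 8 * σ.reg (tmp k) + 8 ≤ W) :
    ∃ σ', Exec W (addrCode a k) σ 5 σ' ∧ Rep β h σ' ∧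
      σ'.reg (tmp k) = β + 8 * σ.reg (tmp k) + a.idx ∧
      ∀ j < k, σ'.reg (tmp j) = σ.reg (tmp j) := by
  have ha := a.idx_lt
  have h1 : tmp k ≠ tmp (k + 1) := tmp_ne (by omega)
  have h3 : (1 : ℕ) ≠ tmp k := by unfold tmp; omega
  have h4 : (1 : ℕ) ≠ tmp (k + 1) := by unfold tmp; omega
  have hb := H.base
  refine ⟨_, Exec.seq (.const _ _ _ (by omega)) <| .seq (.op _ _ _ _ _ ?_) <|
    .seq (.const _ _ _ (by omega)) <| .seq (.op _ _ _ _ _ ?_) <| .op _ _ _ _ _ ?_,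
    ((((H.setTmp _ _).setTmp _ _).setTmp _ _).setTmp _ _).setTmp _ _, ?_, ?_⟩
  · simp [State.setReg, Function.update_of_ne h1, Op.eval]; omega
  · simp [State.setReg, Function.update_of_ne h1, Op.eval]; omega
  · simp [State.setReg, Function.update_of_ne h1, Function.update_of_ne h3,
      Function.update_of_ne h4, Op.eval, hb]; omega
  · simp [State.setReg, Function.update_of_ne h1, Function.update_of_ne h3,
      Function.update_of_ne h4, Op.eval, hb]; omega
  · intro j hj
    have h5 : tmp j ≠ tmp k := tmp_ne (by omega)
    have h6 : tmp j ≠ tmp (k + 1) := tmp_ne (by omega)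
    simp [State.setReg, Function.update_of_ne h5, Function.update_of_ne h6]

/-- Temporaries act as a stack: code at level `k` leaves the levels below `k` alone, so the left
operand survives the evaluation of the right one. -/
theorem exec_exprCode {W β : ℕ} {h : Store} (e : Expr) : ∀ {σ : State} (k : ℕ), Rep β h σ →
    e.Ok W β h → ∃ σ', Exec W (e.code k) σ e.cost σ' ∧ Rep β h σ' ∧
      σ'.reg (tmp k) = e.eval h ∧ ∀ j < k, σ'.reg (tmp j) = σ.reg (tmp j) := by
  induction e with
  | var x =>
    intro σ k H _
    refine ⟨_, .copy _ _ _, H.setTmp _ _, by simp [State.setReg, H.var, Expr.eval], fun j hj => ?_⟩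
    simp [State.setReg, Function.update_of_ne (tmp_ne hj.ne)]
  | const c =>
    intro σ k H hc
    refine ⟨_, .const _ _ _ hc, H.setTmp _ _, by simp [State.setReg, Expr.eval], fun j hj => ?_⟩
    simp [State.setReg, Function.update_of_ne (tmp_ne hj.ne)]
  | op o a b iha ihb =>
    rintro σ k H ⟨ha, hb, hab⟩
    obtain ⟨σ₁, e₁, H₁, r₁, f₁⟩ := iha k H ha
    obtain ⟨σ₂, e₂, H₂, r₂, f₂⟩ := ihb (k + 1) H₁ hb
    have r : σ₂.reg (tmp k) = a.eval h := by rw [f₂ k (by omega), r₁]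
    refine ⟨_, ?_, H₂.setTmp k (o.eval (a.eval h) (b.eval h)), by simp [State.setReg, Expr.eval],
      fun j hj => ?_⟩
    · have := Exec.op (W := W) σ₂ o (tmp k) (tmp k) (tmp (k + 1)) (by rw [r, r₂]; exact hab)
      rw [r, r₂] at this
      have := Exec.seq e₁ (Exec.seq e₂ this)
      rwa [← add_assoc] at this
    · simp [State.setReg, Function.update_of_ne (tmp_ne hj.ne), f₂ j (by omega), f₁ j hj]
  | arr a e ih =>
    rintro σ k H ⟨he, hW⟩
    obtain ⟨σ₁, e₁, H₁, r₁, f₁⟩ := ih k H he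
    obtain ⟨σ₂, e₂, H₂, r₂, f₂⟩ := exec_addrCode (W := W) H₁ a k (by rw [r₁]; exact hW)
    refine ⟨_, .seq e₁ (.seq e₂ (.load _ _ _)), H₂.setTmp _ _, ?_, fun j hj => ?_⟩
    · simp [State.setReg, r₂, r₁, H₂.arr, Expr.eval]
    · simp [State.setReg, Function.update_of_ne (tmp_ne hj.ne), f₂ j hj, f₁ j hj]
  | inp e ih =>
    rintro σ k H ⟨he, hlt⟩
    obtain ⟨σ₁, e₁, H₁, r₁, f₁⟩ := ih k H he
    refine ⟨_, .seq e₁ (.load _ _ _), H₁.setTmp _ _, ?_, fun j hj => ?_⟩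
    · simp [State.setReg, r₁, H₁.inp _ hlt, Expr.eval]
    · simp [State.setReg, Function.update_of_ne (tmp_ne hj.ne), f₁ j hj]

/-! ### Statements -/

/-- `x := e` -/
def assign (x : Var) (e : Expr) : Prog := .seq (e.code 0) (.copy (2 * x.idx) (tmp 0))

/-- `a[i] := e` -/
def putArr (a : Arr) (i e : Expr) : Prog :=
  .seq (e.code 0) (.seq (i.code 1) (.seq (addrCode a 1) (.store (tmp 1) (tmp 0))))

/-- Overwrite a cell of the input. -/
def putInp (i e : Expr) : Prog :=
  .seq (e.code 0) (.seq (i.code 1) (.store (tmp 1) (tmp 0)))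

/-- if `e ≠ 0` then `P` else `Q` -/
def ite (e : Expr) (P Q : Prog) : Prog := .seq (e.code 0) (.branch (tmp 0) P Q)

/-- for `x = 0, …, b - 1` do `P` -/
def forLoop (x b : Var) (P : Prog) : Prog :=
  .seq (assign x 0) <| .seq ((b - x : Expr).code 0) <|
    .loop (tmp 0) <| .seq P <| .seq (assign x (x + 1)) ((b - x : Expr).code 0)

/-- Started in a state that represents `h`, the program `P` halts within `T` steps in a state that
represents one satisfying `Q`. -/
def Runs (W β : ℕ) (P : Prog) (T : ℕ) (Q : Store → Prop) (h : Store) : Prop :=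
  ∀ σ, Rep β h σ → ∃ t σ' h', Exec W P σ t σ' ∧ t ≤ T ∧ Rep β h' σ' ∧ Q h'

/-! ### Hoare rules with time bounds -/

section rules
variable {W β : ℕ} {P P' : Prog} {T T' T₁ T₂ : ℕ} {Q Q' : Store → Prop} {h : Store}

theorem Runs.mono (H : Runs W β P T Q h) (hT : T ≤ T') (hQ : ∀ h', Q h' → Q' h') :
    Runs W β P T' Q' h := by
  intro σ hσ
  obtain ⟨t, σ', h', e, ht, hr, hq⟩ := H σ hσ
  exact ⟨t, σ', h', e, ht.trans hT, hr, hQ _ hq⟩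

theorem Runs.skip (hQ : Q h) : Runs W β .skip 1 Q h :=
  fun σ hσ => ⟨1, σ, h, .skip σ, le_rfl, hσ, hQ⟩

theorem Runs.seq (H : Runs W β P T₁ (fun h' => Runs W β P' T₂ Q h') h) :
    Runs W β (.seq P P') (T₁ + T₂) Q h := by
  intro σ hσ
  obtain ⟨t, σ', h', e, ht, hr, hq⟩ := H σ hσ
  obtain ⟨u, σ'', h'', e', hu, hr', hq'⟩ := hq σ' hr
  exact ⟨t + u, σ'', h'', e.seq e', by omega, hr', hq'⟩

theorem Runs.assign {x : Var} {e : Expr} (he : e.Ok W β h) (hQ : Q (h.set x (e.eval h))) :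
    Runs W β (assign x e) (e.cost + 1) Q h := by
  intro σ hσ
  obtain ⟨σ₁, e₁, H₁, r₁, -⟩ := exec_exprCode e 0 hσ he
  refine ⟨_, _, _, e₁.seq (.copy _ _ _), le_rfl, ?_, hQ⟩
  rw [r₁]
  exact H₁.set _ _

theorem Runs.putArr {a : Arr} {i e : Expr} (he : e.Ok W β h) (hi : i.Ok W β h)
    (hW : β + 8 * i.eval h + 8 ≤ W) (hQ : Q (h.setArr a (i.eval h) (e.eval h))) :
    Runs W β (putArr a i e) (e.cost + (i.cost + 6)) Q h := by
  intro σ hσ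
  obtain ⟨σ₁, e₁, H₁, r₁, -⟩ := exec_exprCode e 0 hσ he
  obtain ⟨σ₂, e₂, H₂, r₂, f₂⟩ := exec_exprCode i 1 H₁ hi
  obtain ⟨σ₃, e₃, H₃, r₃, f₃⟩ := exec_addrCode (W := W) H₂ a 1 (by rw [r₂]; exact hW)
  refine ⟨_, _, _, e₁.seq (e₂.seq (e₃.seq (.store _ _ _))), le_rfl, ?_, hQ⟩
  rw [r₃, r₂, f₃ 0 (by omega), f₂ 0 (by omega), r₁]
  exact H₃.setArr _ _ _

theorem Runs.putInp {i e : Expr} (he : e.Ok W β h) (hi : i.Ok W β h)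
    (hlt : i.eval h < β) (hQ : Q (h.setInp (i.eval h) (e.eval h))) :
    Runs W β (putInp i e) (e.cost + (i.cost + 1)) Q h := by
  intro σ hσ
  obtain ⟨σ₁, e₁, H₁, r₁, -⟩ := exec_exprCode e 0 hσ he
  obtain ⟨σ₂, e₂, H₂, r₂, f₂⟩ := exec_exprCode i 1 H₁ hi
  refine ⟨_, _, _, e₁.seq (e₂.seq (.store _ _ _)), le_rfl, ?_, hQ⟩
  rw [r₂, f₂ 0 (by omega), r₁]
  exact H₂.setInp hlt _

theorem Runs.ite {e : Expr} (he : e.Ok W β h) (h1 : e.eval h ≠ 0 → Runs W β P T Q h)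
    (h0 : e.eval h = 0 → Runs W β P' T Q h) :
    Runs W β (ite e P P') (e.cost + (T + 1)) Q h := by
  intro σ hσ
  obtain ⟨σ₁, e₁, H₁, r₁, -⟩ := exec_exprCode e 0 hσ he
  by_cases hz : e.eval h = 0
  · obtain ⟨t, σ', h', e', ht, hr, hq⟩ := h0 hz σ₁ H₁
    exact ⟨_, σ', h', e₁.seq (.branch_false (r₁.trans hz) e'), by omega, hr, hq⟩
  · obtain ⟨t, σ', h', e', ht, hr, hq⟩ := h1 hz σ₁ H₁
    exact ⟨_, σ', h', e₁.seq (.branch_true (by rwa [r₁]) e'), by omega, hr, hq⟩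

/-- The rule for loops: `I i` holds before the `i`-th execution of the body. -/
theorem Runs.forLoop {x b : Var} (N : ℕ) (I : ℕ → Store → Prop) (hNW : N ≤ W)
    (hI : ∀ i h, I i h → h.var x = i ∧ h.var b = N) (h0 : I 0 (h.set x 0))
    (step : ∀ i < N, ∀ h, I i h → Runs W β P T
      (fun h' => h'.var x = i ∧ I (i + 1) (h'.set x (i + 1))) h)
    (hQ : ∀ h, I N h → Q h) :
    Runs W β (forLoop x b P) (N * (T + 8) + 6) Q h := by
  -- Induction on the number `m` of remaining rounds. The loop tests `tmp 0`, which the body may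
  -- overwrite, so `b - x` is evaluated afresh after each round.
  have key : ∀ m i, i + m = N → ∀ h σ, I i h → Rep β h σ → σ.reg (tmp 0) = m →
      ∃ t σ' h', Exec W (.loop (tmp 0) <| .seq P <| .seq (RAM.assign x (x + 1))
        ((b - x : Expr).code 0)) σ t σ' ∧ t ≤ m * (T + 8) + 1 ∧ Rep β h' σ' ∧ Q h' := by
    intro m
    induction m with
    | zero =>
      intro i hi h σ hIi hσ hreg
      exact ⟨1, σ, h, Exec.loop_stop hreg, by omega, hσ, hQ h (by rwa [← hi])⟩
    | succ m ih =>
      intro i hi h σ hIi hσ hreg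
      obtain ⟨t, σ₁, h₁, e₁, ht, H₁, hx₁, I₁⟩ := step i (by omega) h hIi σ hσ
      obtain ⟨-, hb⟩ := hI _ _ I₁
      have ok1 : (x + 1 : Expr).Ok W β h₁ := by simp [hx₁]; try omega
      obtain ⟨t₂, σ₂, h₂, e₂, ht₂, H₂, hh₂⟩ :=
        Runs.assign (x := x) (Q := fun h' => h' = h₁.set x (i + 1)) ok1 (by simp [hx₁]) σ₁ H₁
      subst hh₂
      have hx₂ : (h₁.set x (i + 1)).var x = i + 1 := by simp
      have ok2 : (b - x : Expr).Ok W β (h₁.set x (i + 1)) := by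
        simp only [Expr.ok_sub, Expr.ok_var, Expr.eval_var, hb, true_and]; omega
      obtain ⟨σ₃, e₃, H₃, r₃, -⟩ := exec_exprCode (b - x : Expr) 0 H₂ ok2
      have r₃' : σ₃.reg (tmp 0) = m := by
        rw [r₃, Expr.eval_sub, Expr.eval_var, Expr.eval_var, hb, hx₂]; omega
      obtain ⟨u, σ₄, h₄, e₄, hu, H₄, Q₄⟩ := ih (i + 1) (by omega) _ σ₃ I₁ H₃ r₃'
      refine ⟨_, σ₄, h₄, .loop_step (by omega) (e₁.seq (e₂.seq e₃)) e₄, ?_, H₄, Q₄⟩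
      -- The overhead of 8 per round: 4 for the increment, 3 for `b - x`, 1 for the test. The 6
      -- outside the rounds are 2 for `x := 0`, 3 for `b - x` and 1 for the final test.
      have c1 : (x + 1 : Expr).cost = 3 := rfl
      have c2 : (b - x : Expr).cost = 3 := rfl
      rw [Nat.succ_mul]
      omega
  intro σ hσ
  obtain ⟨hx, hb⟩ := hI _ _ h0
  obtain ⟨t₂, σ₂, h₂, e₂, ht₂, H₂, hh₂⟩ :=
    Runs.assign (W := W) (x := x) (e := 0) (Q := fun h' => h' = h.set x 0)
      (by simp) (by simp) σ hσ
  subst hh₂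
  have ok2 : (b - x : Expr).Ok W β (h.set x 0) := by
    simp only [Expr.ok_sub, Expr.ok_var, Expr.eval_var, hb, true_and]; omega
  obtain ⟨σ₃, e₃, H₃, r₃, -⟩ := exec_exprCode (b - x : Expr) 0 H₂ ok2
  have r₃' : σ₃.reg (tmp 0) = N := by
    rw [r₃, Expr.eval_sub, Expr.eval_var, Expr.eval_var, hb, hx]; omega
  obtain ⟨u, σ₄, h₄, e₄, hu, H₄, Q₄⟩ := key N 0 (by omega) _ σ₃ h0 H₃ r₃'
  refine ⟨_, σ₄, h₄, e₂.seq (e₃.seq e₄), ?_, H₄, Q₄⟩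
  have c1 : (0 : Expr).cost = 1 := rfl
  have c2 : (b - x : Expr).cost = 3 := rfl
  omega

end rules

end RAM

/-! ### Transitive orientations -/

namespace SimpleGraph

variable {V : Type*}

/-- The forcing relation on ordered pairs of vertices: in a transitive orientation of `Gᶜ`, the
orientations of `u v` and `u w` determine each other if `v` and `w` are adjacent in `G`. -/
def forcing (G : SimpleGraph V) : SimpleGraph (V × V) where
  Adj p q := Gᶜ.Adj p.1 p.2 ∧ Gᶜ.Adj q.1 q.2 ∧
    ((p.1 = q.1 ∧ G.Adj p.2 q.2) ∨ (p.2 = q.2 ∧ G.Adj p.1 q.1))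
  symm := ⟨by
    rintro p q ⟨hp, hq, ⟨h, h'⟩ | ⟨h, h'⟩⟩
    · exact ⟨hq, hp, .inl ⟨h.symm, h'.symm⟩⟩
    · exact ⟨hq, hp, .inr ⟨h.symm, h'.symm⟩⟩⟩
  loopless := ⟨by
    rintro p ⟨-, -, ⟨-, h⟩ | ⟨-, h⟩⟩ <;> exact h.ne rfl⟩

variable {G : SimpleGraph V}

theorem forcing_reachable_swap {p q : V × V} (h : G.forcing.Reachable p q) :
    G.forcing.Reachable p.swap q.swap := by
  rw [reachable_iff_reflTransGen] at h
  induction h with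
  | refl => rfl
  | tail _ hs ih =>
    refine ih.trans (Adj.reachable ?_)
    obtain ⟨h1, h2, h | h⟩ := hs
    · exact ⟨h1.symm, h2.symm, .inr h⟩
    · exact ⟨h1.symm, h2.symm, .inl h⟩

theorem forcing_reachable_adj {p q : V × V} (h : G.forcing.Reachable p q)
    (hp : Gᶜ.Adj p.1 p.2) : Gᶜ.Adj q.1 q.2 := by
  rw [reachable_iff_reflTransGen] at h
  induction h with
  | refl => exact hp
  | tail _ hs ih => exact hs.2.1

/-- In a co-comparability graph, no orientation of an edge forces the opposite orientation. -/
theorem not_forcing_reachable_swap (hG : IsCoComparabilityGraph G) {a b : V} (hab : Gᶜ.Adj a b) :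
    ¬ G.forcing.Reachable (a, b) (b, a) := by
  obtain ⟨n, v, hv⟩ := hG
  have trans : ∀ x y z, v.symm x < v.symm y → v.symm y < v.symm z → Gᶜ.Adj x y → Gᶜ.Adj y z →
      Gᶜ.Adj x z := by
    intro x y z h1 h2 h3 h4
    have := hv _ _ _ h1 h2
    simp only [Equiv.apply_symm_apply] at this
    exact this h3 h4
  have tri : ∀ x y, Gᶜ.Adj x y → v.symm x < v.symm y ∨ v.symm y < v.symm x := fun x y h =>
    lt_or_gt_of_ne fun e => h.ne (v.symm.injective e)
  -- Whether a pair points forwards in the given comparability ordering is constant on forcing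
  -- classes, whereas reversing a pair changes it.
  have key : ∀ p q, G.forcing.Reachable p q →
      (v.symm p.1 < v.symm p.2 ↔ v.symm q.1 < v.symm q.2) := by
    intro p q h
    rw [reachable_iff_reflTransGen] at h
    induction h with
    | refl => rfl
    | @tail x y _ hs ih =>
      rw [ih]
      have step : ∀ x y : V × V, G.forcing.Adj x y → v.symm x.1 < v.symm x.2 →
          v.symm y.1 < v.symm y.2 := by
        rintro ⟨a, b⟩ ⟨c, d⟩ ⟨h1, h2, ⟨h, h'⟩ | ⟨h, h'⟩⟩ hlt <;> dsimp only at * <;> subst h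
        -- If the two pairs pointed in different directions, they would form a directed path through
        -- the common vertex, and transitivity would make its ends non-adjacent in `G`.
        · refine (tri _ _ h2).resolve_right fun hlt' => ?_
          exact (trans _ _ _ hlt' hlt h2.symm h1).2 h'.symm
        · refine (tri _ _ h2).resolve_right fun hlt' => ?_
          exact (trans _ _ _ hlt hlt' h1 h2.symm).2 h'
      exact ⟨step _ _ hs, step _ _ hs.symm⟩
  intro h
  have := key _ _ h
  rcases tri _ _ hab with h1 | h1
  · exact (this.1 h1).asymm h1
  · exact (this.2 h1).asymm h1

/-- The triangle lemma for forcing classes. -/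
theorem forcing_triangle {a b c b' c' : V} (hab : Gᶜ.Adj a b) (hac : Gᶜ.Adj a c)
    (h1 : ¬ G.forcing.Reachable (b, c) (a, c))
    (h2 : ¬ G.forcing.Reachable (b, c) (b, a)) (h : G.forcing.Reachable (b, c) (b', c')) :
    G.forcing.Reachable (a, b) (a, b') ∧ G.forcing.Reachable (a, c) (a, c') := by
  generalize hp : (b', c') = p at h
  rw [reachable_iff_reflTransGen] at h
  induction h generalizing b' c' with
  | refl => cases hp; exact ⟨.rfl, .rfl⟩
  | @tail x y hx hs ih =>
    subst hp
    obtain ⟨b₀, c₀⟩ := x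
    rw [← reachable_iff_reflTransGen] at hx
    obtain ⟨ihb, ihc⟩ := ih rfl
    have hab₀ : Gᶜ.Adj a b₀ := forcing_reachable_adj ihb hab
    have hac₀ : Gᶜ.Adj a c₀ := forcing_reachable_adj ihc hac
    have hs' := hs
    obtain ⟨hbc₀, hbc', ⟨h, h'⟩ | ⟨h, h'⟩⟩ := hs <;> dsimp only at * <;> subst h
    -- The forcing step moves only the second vertex, to `c'`. If `c'` were equal to `a` or adjacent
    -- to it in `G`, the new pair would lie in the class of `(b, a)`, against `h2`. The other case
    -- is symmetric, with `h1`.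
    · refine ⟨ihb, ihc.trans (Adj.reachable ⟨hac₀, ?_, .inl ⟨rfl, h'⟩⟩)⟩
      refine ⟨?_, fun hn => ?_⟩
      · intro e
        dsimp only at e
        subst e
        exact h2 ((hx.trans hs'.reachable).trans (forcing_reachable_swap ihb.symm))
      · refine h2 ((hx.trans hs'.reachable).trans
          (.trans (Adj.reachable ?_) (forcing_reachable_swap ihb.symm)))
        exact ⟨hbc', hab₀.symm, .inl ⟨rfl, hn.symm⟩⟩
    · refine ⟨ihb.trans (Adj.reachable ⟨hab₀, ?_, .inl ⟨rfl, h'⟩⟩), ihc⟩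
      refine ⟨?_, fun hn => ?_⟩
      · intro e
        dsimp only at e
        subst e
        exact h1 ((hx.trans hs'.reachable).trans ihc.symm)
      · refine h1 ((hx.trans hs'.reachable).trans (.trans (Adj.reachable ?_) ihc.symm))
        exact ⟨hbc', hac₀, .inr ⟨rfl, hn.symm⟩⟩

/-! ### The lexicographic orientation -/

variable {n : ℕ}

/-- `lab` assigns to each pair of vertices the lexicographically least pair in its forcing class,
where the pair `(u, v)` is encoded as `u * n + v`. -/
def IsMinLabel (G : SimpleGraph (Fin n)) (lab : Fin n × Fin n → ℕ) : Prop :=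
  ∀ p, (∃ q, G.forcing.Reachable p q ∧ lab p = q.1 * n + q.2) ∧
    ∀ q : Fin n × Fin n, G.forcing.Reachable p q → lab p ≤ q.1 * n + q.2

/-- The orientation of `Gᶜ` that makes the lexicographically least pairs point forwards. -/
def LexDir (G : SimpleGraph (Fin n)) (lab : Fin n × Fin n → ℕ) (u v : Fin n) : Prop :=
  Gᶜ.Adj u v ∧ lab (u, v) < lab (v, u)

theorem pairCode_lt {a b c d : Fin n} (h : a < c) : (a * n + b : ℕ) < c * n + d := by
  have h1 : (a + 1) * n ≤ (c : ℕ) * n := Nat.mul_le_mul_right n h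
  have h2 := b.isLt
  rw [add_mul] at h1
  omega

variable {G : SimpleGraph (Fin n)} {lab : Fin n × Fin n → ℕ}

theorem IsMinLabel.eq_of_reachable (hlab : IsMinLabel G lab) {p q : Fin n × Fin n}
    (h : G.forcing.Reachable p q) : lab p = lab q := by
  have : ∀ p q, G.forcing.Reachable p q → lab p ≤ lab q := by
    intro p q h
    obtain ⟨q', hq', e⟩ := (hlab q).1
    rw [e]
    exact (hlab p).2 _ (h.trans hq')
  exact (this _ _ h).antisymm (this _ _ h.symm)

theorem LexDir.of_reachable (hlab : IsMinLabel G lab) {a b c d : Fin n} (hab : LexDir G lab a b)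
    (h : G.forcing.Reachable (a, b) (c, d)) : LexDir G lab c d := by
  refine ⟨forcing_reachable_adj h hab.1, ?_⟩
  have h1 := hlab.eq_of_reachable h
  have h2 : lab (b, a) = lab (d, c) := hlab.eq_of_reachable (forcing_reachable_swap h)
  rw [← h1, ← h2]
  exact hab.2

theorem LexDir.asymm {a b : Fin n} (hab : LexDir G lab a b) : ¬ LexDir G lab b a :=
  fun h => hab.2.asymm h.2

/-- Equal labels would mean that the classes of `(a, b)` and `(b, a)` share their least pair and
hence coincide. -/
theorem IsMinLabel.total (hG : IsCoComparabilityGraph G) (hlab : IsMinLabel G lab) {a b : Fin n}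
    (hab : Gᶜ.Adj a b) : LexDir G lab a b ∨ LexDir G lab b a := by
  rcases lt_trichotomy (lab (a, b)) (lab (b, a)) with h | h | h
  · exact .inl ⟨hab, h⟩
  · exfalso
    obtain ⟨p, hp, ep⟩ := (hlab (a, b)).1
    obtain ⟨q, hq, eq⟩ := (hlab (b, a)).1
    have hpq : (p.1 * n + p.2 : ℕ) = q.1 * n + q.2 := by rw [← ep, ← eq, h]
    have h1 : p.1 = q.1 := by
      rcases lt_trichotomy p.1 q.1 with h | h | h
      · exact absurd hpq (pairCode_lt h).ne
      · exact h
      · exact absurd hpq (pairCode_lt h).ne'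
    have h2 : p = q := by
      refine Prod.ext h1 (Fin.ext ?_)
      rw [h1] at hpq
      omega
    subst h2
    exact not_forcing_reachable_swap hG hab (hp.trans hq.symm)
  · exact .inr ⟨hab.symm, h⟩

/-- A directed triangle whose last edge has the least label is impossible. -/
theorem LexDir.not_triangle (hlab : IsMinLabel G lab) {u v w : Fin n} (huv : LexDir G lab u v)
    (hvw : LexDir G lab v w) (hwu : LexDir G lab w u) (hle : lab (w, u) ≤ lab (v, w)) : False := by
  obtain ⟨⟨a, b⟩, hab, eab⟩ := (hlab (w, u)).1
  obtain ⟨⟨c, d⟩, hcd, ecd⟩ := (hlab (v, w)).1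
  -- The edge `w → u` is moved to the least pair `(a, b)` of its class. The other two edges of the
  -- triangle follow, so that `v → a → b → v` is again a directed triangle.
  obtain ⟨h1, h2⟩ := forcing_triangle hvw.1 huv.1.symm
    (fun h => huv.asymm (hwu.of_reachable hlab h))
    (fun h => hvw.asymm (hwu.of_reachable hlab h)) hab
  have dva : LexDir G lab v a := hvw.of_reachable hlab h1
  have dbv : LexDir G lab b v := huv.of_reachable hlab (forcing_reachable_swap h2)
  have dab : LexDir G lab a b := hwu.of_reachable hlab hab
  -- From `v → a` the label of `(v, a)`, which is `c * n + d`, is less than `a * n + v`; so `c ≤ a`.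
  -- The assumption `hle` gives `a ≤ c`.
  have hca : c = a := by
    have e1 : lab (v, a) < a * n + v := dva.2.trans_le ((hlab (a, v)).2 (a, v) .rfl)
    rw [← hlab.eq_of_reachable h1] at e1
    dsimp only at eab ecd
    rcases lt_trichotomy c a with h | h | h
    · have := pairCode_lt (b := d) (d := b) h
      omega
    · exact h
    · have := pairCode_lt (b := v) (d := d) h
      omega
  subst hca
  -- The class of `(v, a)` contains `(c, d)`, which now starts at `a`. Moving the edge `v → a` there
  -- carries `b → v` to `b → a`, against `a → b`.
  obtain ⟨h3, h4⟩ := forcing_triangle (b' := c) (c' := d) dbv.1 dab.1.symm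
    (fun h => dab.asymm (dva.of_reachable hlab h)) (fun h => dbv.asymm (dva.of_reachable hlab h))
    (h1.symm.trans hcd)
  exact dab.asymm (dbv.of_reachable hlab h3)

/-- If `u w` were an edge of `G`, then `(u, v)` would force `(w, v)`. If the orientation were `w →
u`, the directed triangle could be rotated until its last edge has the least label. -/
theorem LexDir.trans (hG : IsCoComparabilityGraph G) (hlab : IsMinLabel G lab) {u v w : Fin n}
    (huv : LexDir G lab u v) (hvw : LexDir G lab v w) : LexDir G lab u w := by
  have huw : Gᶜ.Adj u w := by
    refine ⟨?_, fun h => ?_⟩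
    · rintro rfl
      exact huv.asymm hvw
    · refine hvw.asymm (huv.of_reachable hlab (Adj.reachable ⟨huv.1, hvw.1.symm, .inr ⟨rfl, h⟩⟩))
  refine (hlab.total hG huw).resolve_right fun hwu => ?_
  rcases le_total (lab (w, u)) (lab (v, w)) with h | h
  · exact LexDir.not_triangle hlab huv hvw hwu h
  · rcases le_total (lab (v, w)) (lab (u, v)) with h' | h'
    · exact LexDir.not_triangle hlab hwu huv hvw h'
    · exact LexDir.not_triangle hlab hvw hwu huv (h'.trans h)

/-! ### Comparability orderings from orientations -/

open Classical in
/-- The number of vertices with an edge to `v`. -/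
noncomputable def lexDeg (G : SimpleGraph (Fin n)) (lab : Fin n × Fin n → ℕ) (v : Fin n) : ℕ :=
  (Finset.univ.filter fun u => LexDir G lab u v).card

/-- The position of `v` in the order by increasing values of `f`, ties broken by index. -/
def sortRank (f : Fin n → ℕ) (v : Fin n) : ℕ :=
  (Finset.univ.filter fun u : Fin n => f u * n + u < f v * n + v).card

theorem sortRank_lt (f : Fin n → ℕ) (v : Fin n) : sortRank f v < n := by
  have : sortRank f v < (Finset.univ : Finset (Fin n)).card := by
    refine Finset.card_lt_card ?_
    rw [Finset.ssubset_univ_iff]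
    intro h
    have := Finset.mem_univ v
    rw [← h] at this
    simp at this
  simpa using this

theorem sortRank_lt_iff (f : Fin n → ℕ) {u v : Fin n} :
    sortRank f u < sortRank f v ↔ f u * n + u < f v * n + v := by
  have mono : ∀ u v : Fin n, f u * n + u ≤ f v * n + v → sortRank f u ≤ sortRank f v := by
    intro u v h
    refine Finset.card_le_card fun w hw => ?_
    simp only [Finset.mem_filter, Finset.mem_univ, true_and] at hw ⊢
    omega
  refine ⟨fun h => ?_, fun h => ?_⟩
  · by_contra! h'
    exact (mono _ _ h').not_gt h
  · refine Finset.card_lt_card ⟨fun w hw => ?_, fun hs => ?_⟩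
    · simp only [Finset.mem_filter, Finset.mem_univ, true_and] at hw ⊢
      omega
    · have : u ∈ Finset.univ.filter fun w : Fin n => f w * n + w < f v * n + v := by simpa using h
      have := hs this
      simp at this

theorem sortRank_injective (f : Fin n → ℕ) : Function.Injective (sortRank f) := by
  intro u v h
  have h1 := (sortRank_lt_iff f (u := u) (v := v)).not.1 (by omega)
  have h2 := (sortRank_lt_iff f (u := v) (v := u)).not.1 (by omega)
  have h3 : f u * n + u = f v * n + v := by omega
  have hn : 0 < n := u.pos
  have h4 := congrArg (· % n) h3
  simp only [Nat.mul_add_mod_of_lt u.isLt, Nat.mul_add_mod_of_lt v.isLt] at h4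
  exact Fin.ext h4

/-- The enumeration of the vertices by increasing values of `f`. -/
noncomputable def sortEquiv (f : Fin n → ℕ) : Fin n ≃ Fin n :=
  (Equiv.ofBijective (fun v => ⟨sortRank f v, sortRank_lt f v⟩ : Fin n → Fin n)
    (Finite.injective_iff_bijective.1 fun _ _ h =>
      sortRank_injective f (congrArg Fin.val h))).symm

theorem sortEquiv_sortRank (f : Fin n → ℕ) (v : Fin n) :
    sortEquiv f ⟨sortRank f v, sortRank_lt f v⟩ = v := by
  unfold sortEquiv
  exact Equiv.ofBijective_symm_apply_apply _ _ v

theorem sortRank_sortEquiv (f : Fin n → ℕ) (p : Fin n) : sortRank f (sortEquiv f p) = p := by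
  obtain ⟨v, rfl⟩ := (sortEquiv f).symm.surjective p
  have : (sortEquiv f).symm v = ⟨sortRank f v, sortRank_lt f v⟩ := by
    rw [Equiv.symm_apply_eq, sortEquiv_sortRank]
  rw [Equiv.apply_symm_apply, this]

/-- By transitivity every predecessor of `u` is one of `v`, and `u` itself is a further one. -/
theorem lexDeg_lt (hG : IsCoComparabilityGraph G) (hlab : IsMinLabel G lab) {u v : Fin n}
    (h : LexDir G lab u v) : lexDeg G lab u < lexDeg G lab v := by
  classical
  refine Finset.card_lt_card ⟨fun w hw => ?_, fun hs => ?_⟩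
  · simp only [Finset.mem_filter, Finset.mem_univ, true_and] at hw ⊢
    exact hw.trans hG hlab h
  · have : u ∈ Finset.univ.filter fun w => LexDir G lab w v := by simpa using h
    have := hs this
    simp only [Finset.mem_filter, Finset.mem_univ, true_and] at this
    exact this.asymm this

/-- In-degrees strictly increase along directed edges, so sorting by them is a linear extension of
the orientation, however ties are broken. -/
theorem isComparabilityOrdering_sortEquiv (hG : IsCoComparabilityGraph G)
    (hlab : IsMinLabel G lab) : IsComparabilityOrdering Gᶜ (sortEquiv (lexDeg G lab)) := by
  have key : ∀ p q, p < q → Gᶜ.Adj (sortEquiv (lexDeg G lab) p) (sortEquiv (lexDeg G lab) q) →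
      LexDir G lab (sortEquiv (lexDeg G lab) p) (sortEquiv (lexDeg G lab) q) := by
    intro p q hpq hadj
    refine (hlab.total hG hadj).resolve_right fun h => ?_
    have h1 := lexDeg_lt hG hlab h
    have h2 : sortRank (lexDeg G lab) (sortEquiv (lexDeg G lab) p) <
        sortRank (lexDeg G lab) (sortEquiv (lexDeg G lab) q) := by
      rw [sortRank_sortEquiv, sortRank_sortEquiv]; exact hpq
    rw [sortRank_lt_iff] at h2
    have h3 := Nat.mul_le_mul_right n (Nat.succ_le_of_lt h1)
    have h4 := (sortEquiv (lexDeg G lab) q).isLt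
    rw [Nat.succ_mul] at h3
    omega
  intro p q r hpq hqr h1 h2
  exact ((key _ _ hpq h1).trans hG hlab (key _ _ hqr h2)).1

end SimpleGraph

/-! ### Dynamic programming over the last vertices of the color classes -/

section Dynamic

open Function

variable {n s : ℕ}

/-- The number with base `n` digits `f 0, …, f (s - 1)`. -/
def stateCode (f : Fin s → Fin n) : ℕ := (finFunctionFinEquiv f : Fin (n ^ s))

theorem stateCode_lt (f : Fin s → Fin n) : stateCode f < n ^ s := Fin.isLt _

theorem exists_stateCode_eq {a : ℕ} (ha : a < n ^ s) : ∃ f : Fin s → Fin n, stateCode f = a :=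
  ⟨finFunctionFinEquiv.symm ⟨a, ha⟩, by simp [stateCode]⟩

theorem stateCode_injective : Injective (stateCode : (Fin s → Fin n) → ℕ) := fun _ _ h =>
  finFunctionFinEquiv.injective (Fin.ext h)

theorem stateCode_digit (f : Fin s → Fin n) (i : Fin s) :
    stateCode f / n ^ (i : ℕ) % n = f i := by
  have := congrFun (finFunctionFinEquiv.symm_apply_apply f) i
  rw [← this]
  rfl

theorem stateCode_eq_sum (f : Fin s → Fin n) :
    stateCode f = ∑ i : Fin s, (f i : ℕ) * n ^ (i : ℕ) := by
  simp [stateCode]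

theorem digit_mul_le_stateCode (f : Fin s → Fin n) (i : Fin s) :
    (f i : ℕ) * n ^ (i : ℕ) ≤ stateCode f := by
  rw [stateCode_eq_sum]
  exact Finset.single_le_sum (f := fun i : Fin s => (f i : ℕ) * n ^ (i : ℕ))
    (fun _ _ => Nat.zero_le _) (Finset.mem_univ i)

theorem stateCode_update (f : Fin s → Fin n) (i : Fin s) (t : Fin n) :
    stateCode (update f i t) = stateCode f - f i * n ^ (i : ℕ) + t * n ^ (i : ℕ) := by
  have h : stateCode (update f i t) + f i * n ^ (i : ℕ) = stateCode f + t * n ^ (i : ℕ) := by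
    rw [stateCode_eq_sum, stateCode_eq_sum, ← Finset.add_sum_erase _ _ (Finset.mem_univ i),
      ← Finset.add_sum_erase (a := i) (f := fun i : Fin s => (f i : ℕ) * n ^ (i : ℕ)) _
        (Finset.mem_univ i), update_self]
    have : ∑ x ∈ Finset.univ.erase i, ((update f i t x : Fin n) : ℕ) * n ^ (x : ℕ) =
        ∑ x ∈ Finset.univ.erase i, (f x : ℕ) * n ^ (x : ℕ) :=
      Finset.sum_congr rfl fun x hx => by rw [update_of_ne (Finset.ne_of_mem_erase hx)]
    omega
  have := digit_mul_le_stateCode f i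
  omega

/-- The start state, in which every digit is the default value `n - 1`, has the largest code. -/
theorem stateCode_const_last (hn : 1 ≤ n) :
    stateCode (fun _ : Fin s => (⟨n - 1, by omega⟩ : Fin n)) = n ^ s - 1 := by
  rw [stateCode_eq_sum]
  have : ∀ s : ℕ, ∑ i : Fin s, (n - 1) * n ^ (i : ℕ) + 1 = n ^ s := by
    intro s
    induction s with
    | zero => simp
    | succ s ih =>
      rw [Fin.sum_univ_castSucc]
      simp only [Fin.val_castSucc, Fin.val_last]
      rw [add_right_comm, ih, pow_succ]
      obtain ⟨m, rfl⟩ : ∃ m, n = m + 1 := ⟨n - 1, by omega⟩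
      simp only [Nat.add_sub_cancel]
      ring
  have := this s
  simp only
  omega

variable (G : SimpleGraph (Fin n)) (L : Fin n → Finset (Fin s)) (ord : Fin n ≃ Fin n)

/-- The vertex at position `t` can get color `i` if `f i` is the position of the last vertex of
color `i` (or `n - 1` if there is none). -/
def CanUse (t : Fin n) (f : Fin s → Fin n) (i : Fin s) : Prop :=
  i ∈ L (ord t) ∧ ((f i : ℕ) = n - 1 ∨ ¬ G.Adj (ord (f i)) (ord t))

/-- The last `k` vertices can be colored, starting from the state `f`. -/
def Completable : ℕ → (Fin s → Fin n) → Prop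
  | 0, _ => True
  | k + 1, f => ∃ t : Fin n, t + (k + 1) = n ∧ ∃ i, CanUse G L ord t f i ∧
      Completable k (update f i t)

/-- `c` is a partial coloring of the first `t` vertices, and `f` is its state. -/
structure PartialColoring (t : ℕ) (f : Fin s → Fin n) (c : Fin n → Fin s) : Prop where
  mem : ∀ p : Fin n, (p : ℕ) < t → c p ∈ L (ord p)
  proper : ∀ p q : Fin n, p < q → (q : ℕ) < t → c p = c q → ¬ G.Adj (ord p) (ord q)
  state : ∀ i, ((f i : ℕ) = n - 1 ∧ ∀ p : Fin n, (p : ℕ) < t → c p ≠ i) ∨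
    ((f i : ℕ) < t ∧ c (f i) = i ∧ ∀ p : Fin n, (p : ℕ) < t → c p = i → p ≤ f i)

variable {G L ord}

/-- Only the last vertex of the color class is tested; the comparability ordering takes care of the
earlier ones. -/
theorem PartialColoring.step (hord : IsComparabilityOrdering Gᶜ ord) {t : Fin n}
    {f : Fin s → Fin n} {c : Fin n → Fin s} (H : PartialColoring G L ord t f c) {i : Fin s}
    (hi : CanUse G L ord t f i) :
    PartialColoring G L ord (t + 1) (update f i t) (update c t i) where
  mem p hp := by
    rcases eq_or_ne p t with rfl | hpt
    · rw [update_self]; exact hi.1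
    · rw [update_of_ne hpt]
      exact H.mem p (by have := Fin.val_ne_of_ne hpt; omega)
  proper p q hpq hq hc := by
    have hpt : p ≠ t := fun e => by subst e; have : (p : ℕ) < q := hpq; omega
    have hpq' : (p : ℕ) < q := hpq
    rw [update_of_ne hpt] at hc
    rcases eq_or_ne q t with rfl | hqt
    · rw [update_self] at hc
      rcases H.state i with ⟨-, h⟩ | ⟨h1, h2, h3⟩
      · exact absurd hc (h p hpq)
      · have hadj : ¬ G.Adj (ord (f i)) (ord q) := by
          -- The value `n - 1` can safely stand for "no vertex": a vertex at the last position
          -- precedes no other, so it is never the last vertex of a class that is still to be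
          -- extended.
          refine hi.2.resolve_left fun h => ?_
          have := q.isLt
          omega
        rcases (h3 p hpq hc).eq_or_lt with rfl | hlt
        · exact hadj
        · have h4 := H.proper p (f i) hlt h1 (by rw [h2, hc])
          have h5 : Gᶜ.Adj (ord p) (ord (f i)) := ⟨fun e => hlt.ne (ord.injective e), h4⟩
          have h6 : Gᶜ.Adj (ord (f i)) (ord q) :=
            ⟨fun e => (Fin.ne_of_lt h1) (ord.injective e), hadj⟩
          -- The vertices at `p`, `f i`, `q` are consecutively non-adjacent in `G`, hence so are
          -- those at `p` and `q`.
          exact (hord p (f i) q hlt h1 h5 h6).2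
    · rw [update_of_ne hqt] at hc
      exact H.proper p q hpq (by have := Fin.val_ne_of_ne hqt; omega) hc
  state j := by
    rcases eq_or_ne j i with rfl | hji
    · right
      refine ⟨by simp, by simp, fun p hp _ => ?_⟩
      rw [update_self, Fin.le_def]
      omega
    · rw [update_of_ne hji]
      rcases H.state j with ⟨h1, h2⟩ | ⟨h1, h2, h3⟩
      · refine .inl ⟨h1, fun p hp => ?_⟩
        rcases eq_or_ne p t with rfl | hpt
        · rw [update_self]; exact hji.symm
        · rw [update_of_ne hpt]
          exact h2 p (by have := Fin.val_ne_of_ne hpt; omega)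
      · refine .inr ⟨by omega, ?_, fun p hp => ?_⟩
        · rw [update_of_ne (Fin.ne_of_lt h1), h2]
        · rcases eq_or_ne p t with rfl | hpt
          · rw [update_self]; exact fun e => absurd e hji.symm
          · rw [update_of_ne hpt]
            exact h3 p (by have := Fin.val_ne_of_ne hpt; omega)

theorem partialColoring_zero (hn : 1 ≤ n) (c : Fin n → Fin s) :
    PartialColoring G L ord 0 (fun _ => ⟨n - 1, by omega⟩) c where
  mem p hp := by omega
  proper p q hpq hq := by omega
  state i := .inl ⟨rfl, fun p hp => by omega⟩

theorem PartialColoring.exists_isListColoring {f : Fin s → Fin n} {c : Fin n → Fin s}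
    (H : PartialColoring G L ord n f c) :
    ∃ c' : G.Coloring (Fin s), IsListColoring G L c' ∧ ∀ v, c' v = c (ord.symm v) := by
  refine ⟨SimpleGraph.Coloring.mk (fun v => c (ord.symm v)) ?_, fun v => ?_, fun v => rfl⟩
  · intro u v huv hc
    rcases lt_trichotomy (ord.symm u) (ord.symm v) with h | h | h
    · have := H.proper _ _ h (Fin.isLt _) hc
      simp only [Equiv.apply_symm_apply] at this
      exact this huv
    · exact huv.ne (ord.symm.injective h)
    · have := H.proper _ _ h (Fin.isLt _) hc.symm
      simp only [Equiv.apply_symm_apply] at this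
      exact this huv.symm
  · have := H.mem (ord.symm v) (Fin.isLt _)
    rw [Equiv.apply_symm_apply] at this
    exact this

/-- The given coloring, restricted to the first `t` positions, is a partial coloring with a suitable
state. As it is proper, its own color for the next vertex always passes the test. -/
theorem completable_of_isListColoring (hn : 1 ≤ n) (hord : IsComparabilityOrdering Gᶜ ord)
    {c : G.Coloring (Fin s)} (hc : IsListColoring G L c) :
    Completable G L ord n (fun _ => ⟨n - 1, by omega⟩) := by
  have key : ∀ k t (f : Fin s → Fin n), t + k = n →
      PartialColoring G L ord t f (fun p => c (ord p)) → Completable G L ord k f := by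
    intro k
    induction k with
    | zero => intros; trivial
    | succ k ih =>
      intro t f hk H
      have hi : CanUse G L ord ⟨t, by omega⟩ f (c (ord ⟨t, by omega⟩)) := by
        refine ⟨hc _, ?_⟩
        rcases H.state (c (ord ⟨t, by omega⟩)) with ⟨h, -⟩ | ⟨-, h, -⟩
        · exact .inl h
        · exact .inr fun hadj => c.valid hadj h
      refine ⟨⟨t, by omega⟩, hk, _, hi, ih (t + 1) _ (by omega) ?_⟩
      have := H.step (t := ⟨t, by omega⟩) hord hi
      rwa [update_eq_self] at this
  exact key n 0 _ (by omega) (partialColoring_zero hn _)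

end Dynamic

/-! ### Least labels by iterated relaxation -/

namespace SimpleGraph

open Function

variable {n : ℕ} {G : SimpleGraph (Fin n)}

theorem pairCode_injective {p q : Fin n × Fin n} (h : (p.1 * n + p.2 : ℕ) = q.1 * n + q.2) :
    p = q := by
  have h1 : p.1 = q.1 := by
    rcases lt_trichotomy p.1 q.1 with h' | h' | h'
    · exact absurd h (pairCode_lt h').ne
    · exact h'
    · exact absurd h (pairCode_lt h').ne'
  refine Prod.ext h1 (Fin.ext ?_)
  rw [h1] at h
  omega

/-- `A` assigns to each pair a pair of the same class that is at least as small as all pairs within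
distance `r`, and as small as all pairs within distance `r` of the neighbors of the pair in `D`. -/
structure LabelApprox (G : SimpleGraph (Fin n)) (r : ℕ)
    (D : Fin n × Fin n → Fin n × Fin n → Prop) (A : Fin n × Fin n → ℕ) : Prop where
  attained : ∀ p, ∃ q, G.forcing.Reachable p q ∧ A p = q.1 * n + q.2
  le : ∀ p q, (∃ w : G.forcing.Walk p q, w.length ≤ r) → A p ≤ q.1 * n + q.2
  le_of_adj : ∀ p p', D p p' → G.forcing.Adj p p' →
    ∀ q, (∃ w : G.forcing.Walk p' q, w.length ≤ r) → A p ≤ q.1 * n + q.2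

variable {r : ℕ} {D D' : Fin n × Fin n → Fin n × Fin n → Prop} {A : Fin n × Fin n → ℕ}

theorem labelApprox_code (G : SimpleGraph (Fin n)) :
    LabelApprox G 0 (fun _ _ => False) (fun p => p.1 * n + p.2) where
  attained p := ⟨p, .rfl, rfl⟩
  le p q := by
    rintro ⟨w, hw⟩
    cases w with
    | nil => exact le_rfl
    | cons _ _ => simp at hw
  le_of_adj _ _ h := h.elim

theorem LabelApprox.mono (H : LabelApprox G r D A)
    (hD : ∀ p p', G.forcing.Adj p p' → D' p p' → D p p') : LabelApprox G r D' A :=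
  ⟨H.attained, H.le, fun p p' h ha => H.le_of_adj p p' (hD p p' ha h) ha⟩

/-- The truncated difference is nonzero exactly if the label of `y` is smaller. Labels only decrease
and stay within their class, and the label of `y` already covers all pairs within distance `r` of
`y`. -/
theorem LabelApprox.relax (H : LabelApprox G r D A) {x y : Fin n × Fin n}
    (hxy : G.forcing.Adj x y) :
    LabelApprox G r (fun p p' => D p p' ∨ (p = x ∧ p' = y))
      (update A x (if A x - A y ≠ 0 then A y else A x)) := by
  have hle : ∀ p, update A x (if A x - A y ≠ 0 then A y else A x) p ≤ A p := by
    intro p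
    rcases eq_or_ne p x with rfl | hp
    · rw [update_self]; split_ifs <;> omega
    · rw [update_of_ne hp]
  refine ⟨fun p => ?_, fun p q h => (hle p).trans (H.le p q h), ?_⟩
  · rcases eq_or_ne p x with rfl | hp
    · rw [update_self]
      split_ifs
      · obtain ⟨q, hq, e⟩ := H.attained y
        exact ⟨q, hxy.reachable.trans hq, e⟩
      · exact H.attained p
    · rw [update_of_ne hp]
      exact H.attained p
  · rintro p p' (h | ⟨rfl, rfl⟩) ha q hq
    · exact (hle p).trans (H.le_of_adj p p' h ha q hq)
    · refine le_trans ?_ (H.le p' q hq)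
      rw [update_self]
      split_ifs <;> omega

/-- A walk of length at most `r + 1` is trivial or consists of an edge, which has been relaxed, and
a walk of length at most `r`. -/
theorem LabelApprox.succ (H : LabelApprox G r D A) (hD : ∀ p p', G.forcing.Adj p p' → D p p') :
    LabelApprox G (r + 1) (fun _ _ => False) A where
  attained := H.attained
  le p q := by
    rintro ⟨w, hw⟩
    cases w with
    | nil => exact H.le p p ⟨.nil, by simp⟩
    | cons h w =>
      rw [Walk.length_cons] at hw
      exact H.le_of_adj _ _ (hD _ _ h) h _ ⟨w, by omega⟩
  le_of_adj _ _ h := h.elim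

/-- The forcing graph has `n * n` vertices, so its paths are shorter than `n * n` and that many
rounds suffice. -/
theorem LabelApprox.isMinLabel (H : LabelApprox G (n * n) D A) : IsMinLabel G A := by
  classical
  refine fun p => ⟨H.attained p, fun q hq => H.le p q ?_⟩
  obtain ⟨w⟩ := hq
  refine ⟨w.toPath, ?_⟩
  have := w.toPath.2.length_lt
  rw [Fintype.card_prod, Fintype.card_fin] at this
  exact this.le

/-- The relaxations performed before the loop counters reach `i`, `j`, `k`. -/
def relaxedBefore (i j k : ℕ) (p p' : Fin n × Fin n) : Prop :=
  ∃ a b c : Fin n, (a < i ∨ (a : ℕ) = i ∧ (b < j ∨ (b : ℕ) = j ∧ c < k)) ∧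
    (p = (a, b) ∧ p' = (a, c) ∨ p = (b, a) ∧ p' = (c, a))

theorem relaxedBefore_zero {p p' : Fin n × Fin n} : ¬ relaxedBefore 0 0 0 p p' := by
  rintro ⟨a, b, c, h, -⟩
  omega

theorem relaxedBefore_succ {i j k : Fin n} {p p' : Fin n × Fin n}
    (h : relaxedBefore i j (k + 1) p p') :
    relaxedBefore i j k p p' ∨ (p = (i, j) ∧ p' = (i, k)) ∨ p = (j, i) ∧ p' = (k, i) := by
  obtain ⟨a, b, c, h1, h2⟩ := h
  by_cases e : a = i ∧ b = j ∧ c = k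
  · obtain ⟨rfl, rfl, rfl⟩ := e
    exact .inr h2
  · refine .inl ⟨a, b, c, ?_, h2⟩
    simp only [Fin.ext_iff] at e
    omega

theorem relaxedBefore_next {i j : ℕ} {p p' : Fin n × Fin n}
    (h : relaxedBefore i (j + 1) 0 p p') : relaxedBefore i j n p p' := by
  obtain ⟨a, b, c, h1, h2⟩ := h
  exact ⟨a, b, c, by omega, h2⟩

theorem relaxedBefore_next' {i : ℕ} {p p' : Fin n × Fin n}
    (h : relaxedBefore (i + 1) 0 0 p p') : relaxedBefore i n 0 p p' := by
  obtain ⟨a, b, c, h1, h2⟩ := h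
  exact ⟨a, b, c, by omega, h2⟩

theorem relaxedBefore_of_adj {p p' : Fin n × Fin n} (h : G.forcing.Adj p p') :
    relaxedBefore n 0 0 p p' := by
  obtain ⟨a, b⟩ := p
  obtain ⟨c, d⟩ := p'
  obtain ⟨-, -, ⟨h, -⟩ | ⟨h, -⟩⟩ := h <;> dsimp only at h <;> subst h
  · exact ⟨a, b, d, by omega, .inl ⟨rfl, rfl⟩⟩
  · exact ⟨b, a, c, by omega, .inr ⟨rfl, rfl⟩⟩

end SimpleGraph

/-! ### Programs for the least labels -/

namespace RAM

open SimpleGraph Function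

theorem Runs.weaken {W β : ℕ} {P : Prog} {T T' : ℕ} {Q : Store → Prop} {h : Store}
    (H : Runs W β P T Q h) (hT : T ≤ T') : Runs W β P T' Q h := H.mono hT fun _ => id

/-- The variables with a fixed value in the main part of the program. -/
def Var.isParam : Var → Bool
  | n | s | sq | pw => true
  | _ => false

open Classical in
/-- The abstract state `h` holds the instance `(G, L)` and the derived parameters. -/
structure Env {n s : ℕ} (G : SimpleGraph (Fin n)) (L : Fin n → Finset (Fin s)) (h : Store) :
    Prop where
  var_n : h.var .n = n
  var_s : h.var .s = s
  var_sq : h.var .sq = n * n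
  var_pw : h.var .pw = n ^ s
  adj : ∀ u v : Fin n, h.inp (2 + u * n + v) = if G.Adj u v then 1 else 0
  lst : ∀ (v : Fin n) (i : Fin s), h.inp (2 + n * n + v * s + i) = if i ∈ L v then 1 else 0

section
variable {n s : ℕ} {G : SimpleGraph (Fin n)} {L : Fin n → Finset (Fin s)} {h : Store}

theorem Env.set (H : Env G L h) {x : Var} (hx : x.isParam = false) (a : ℕ) :
    Env G L (h.set x a) := by
  cases x <;> first
    | exact ⟨H.var_n, H.var_s, H.var_sq, H.var_pw, H.adj, H.lst⟩
    | cases hx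

theorem Env.setArr (H : Env G L h) (a : Arr) (i v : ℕ) : Env G L (h.setArr a i v) :=
  ⟨H.var_n, H.var_s, H.var_sq, H.var_pw, H.adj, H.lst⟩

/-- The word size suffices for the instance. -/
def Fits (n s W : ℕ) : Prop :=
  2 + n * n + n * s + 8 * (n * n + n + (n + 2) * n ^ s) + 100 ≤ W

/-- The number of cells of the input. -/
abbrev inputSize (n s : ℕ) : ℕ := 2 + n * n + n * s

theorem mul_add_lt {a b m k : ℕ} (ha : a < m) (hb : b < k) : a * k + b < m * k := by
  have := Nat.mul_le_mul_right k (Nat.succ_le_of_lt ha)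
  rw [Nat.succ_mul] at this
  omega

/-- The labels of the pairs of vertices. -/
def labels (n : ℕ) (h : Store) (p : Fin n × Fin n) : ℕ := h.arr .lab (p.1 * n + p.2)

theorem labels_setArr (h : Store) (x : Fin n × Fin n) (v : ℕ) :
    labels n (h.setArr .lab (x.1 * n + x.2) v) = update (labels n h) x v := by
  funext p
  by_cases hp : p = x
  · subst hp; simp [labels]
  · rw [update_of_ne hp]
    simp only [labels, Store.setArr_arr, true_and]
    rw [if_neg fun e => hp (pairCode_injective e)]

/-- `lab[x] := min lab[x] lab[y]` -/
def relaxPair (x y : Expr) : Prog :=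
  ite (.arr .lab x - .arr .lab y) (putArr .lab x (.arr .lab y)) .skip

theorem runs_relaxPair {W : ℕ} (hW : Fits n s W) {x y : Expr} {p q : Fin n × Fin n}
    {r : ℕ} {D : Fin n × Fin n → Fin n × Fin n → Prop} (H : LabelApprox G r D (labels n h))
    (hpq : G.forcing.Adj p q)
    (hx : x.eval h = p.1 * n + p.2) (hy : y.eval h = q.1 * n + q.2)
    (ox : x.Ok W (inputSize n s) h) (oy : y.Ok W (inputSize n s) h) {Q : Store → Prop}
    (hQ : ∀ m, LabelApprox G r (fun a b => D a b ∨ (a = p ∧ b = q))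
      (labels n (h.setArr .lab (p.1 * n + p.2) m)) →
      Q (h.setArr .lab (p.1 * n + p.2) m)) :
    Runs W (inputSize n s) (relaxPair x y) (2 * x.cost + 2 * y.cost + 30) Q h := by
  have h1 := mul_add_lt p.1.isLt p.2.isLt
  have h2 := mul_add_lt q.1.isLt q.2.isLt
  have lb : ∀ p : Fin n × Fin n, h.arr .lab (p.1 * n + p.2) < n * n := by
    intro p
    obtain ⟨q, -, e⟩ := H.attained p
    have e' : h.arr .lab (p.1 * n + p.2) = _ := e
    rw [e']
    exact mul_add_lt q.1.isLt q.2.isLt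
  have l1 := lb p
  have l2 := lb q
  unfold Fits at hW
  have o1 : (Expr.arr .lab x).Ok W (inputSize n s) h :=
    ⟨ox, by rw [hx]; dsimp only [inputSize]; omega⟩
  have o2 : (Expr.arr .lab y).Ok W (inputSize n s) h :=
    ⟨oy, by rw [hy]; dsimp only [inputSize]; omega⟩
  have R := H.relax hpq
  have e1 : (Expr.arr .lab x - Expr.arr .lab y).eval h = labels n h p - labels n h q := by
    simp [hx, hy, labels]
  have c1 : (Expr.arr .lab x - Expr.arr .lab y).cost = (x.cost + 6) + (y.cost + 6) + 1 := rfl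
  have o3 : (Expr.arr .lab x - Expr.arr .lab y).Ok W (inputSize n s) h := by
    refine ⟨o1, o2, ?_⟩
    change (Expr.arr .lab x - Expr.arr .lab y).eval h ≤ W
    rw [e1]
    simp only [labels]
    omega
  refine (Runs.ite (T := x.cost + y.cost + 13) o3 (fun hne => ?_) (fun heq => ?_)).weaken
    (by rw [c1]; omega)
  · refine (Runs.putArr o2 ox (by rw [hx]; dsimp only [inputSize]; omega) ?_).weaken
      (by simp only [Expr.cost]; omega)
    rw [hx]
    refine hQ _ ?_
    rw [e1] at hne
    rw [if_pos hne] at R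
    rw [labels_setArr]
    simpa [hy, labels] using R
  · refine (Runs.skip ?_).weaken (by omega)
    rw [e1] at heq
    rw [if_neg (by omega)] at R
    -- Skipping is the same as writing back the current label, so both branches meet the same
    -- condition `hQ`.
    have hs : h.setArr .lab (p.1 * n + p.2) (labels n h p) = h := by
      ext : 1 <;> try rfl
      funext b j
      simp only [Store.setArr_arr, labels]
      split_ifs with hb
      · rw [hb.1, hb.2]
      · rfl
    have := hQ (labels n h p) (by rw [labels_setArr]; exact R)
    rwa [hs] at this

/-- Label every pair by its own code. -/
def initLabels : Prog := forLoop .r .sq (putArr .lab Var.r Var.r)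

theorem runs_initLabels {W : ℕ} (hW : Fits n s W) (H : Env G L h) :
    Runs W (inputSize n s) initLabels (n * n * 16 + 6) (fun h' => Env G L h' ∧
      LabelApprox G 0 (fun _ _ => False) (labels n h')) h := by
  unfold Fits at hW
  refine Runs.forLoop (T := 8) (n * n) (fun r h => h.var .r = r ∧ Env G L h ∧
    ∀ k < r, h.arr .lab k = k) (by omega) (fun i h hI => ⟨hI.1, hI.2.1.var_sq⟩)
    ⟨by simp, H.set rfl 0, by simp⟩ ?_ ?_
  · rintro r hr h ⟨h1, h2, h3⟩
    refine (Runs.putArr (by simp) (by simp) (by simp [h1, inputSize]; omega) ?_).weaken (by decide)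
    refine ⟨by simp [h1], by simp, (h2.setArr _ _ _).set rfl _, fun k hk => ?_⟩
    simp only [Store.set_arr, Store.setArr_arr, true_and, Expr.eval_var, h1]
    split_ifs with e
    · exact e.symm
    · exact h3 k (by omega)
  · rintro h ⟨-, h2, h3⟩
    refine ⟨h2, ?_⟩
    have : labels n h = fun p => p.1 * n + p.2 := by
      funext p
      exact h3 _ (mul_add_lt p.1.isLt p.2.isLt)
    rw [this]
    exact labelApprox_code G

/-- Relax the labels of the pairs `(i, j)` and `(j, i)` if `i j` and `i k` are non-edges and `j k` is
an edge. -/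
def relaxTriple : Prog :=
  ite (.inp (2 + Var.j * Var.n + Var.k) - .inp (2 + Var.i * Var.n + Var.j)
      - .inp (2 + Var.i * Var.n + Var.k))
    (.seq (relaxPair (Var.i * Var.n + Var.j) (Var.i * Var.n + Var.k))
      (relaxPair (Var.j * Var.n + Var.i) (Var.k * Var.n + Var.i)))
    .skip

theorem runs_relaxTriple {W : ℕ} (hW : Fits n s W) (H : Env G L h) {i j k : Fin n} {r : ℕ}
    (hr : h.var .r = r) (hi : h.var .i = i) (hj : h.var .j = j) (hk : h.var .k = k)
    (HA : LabelApprox G r (relaxedBefore i j k) (labels n h)) :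
    Runs W (inputSize n s) relaxTriple 200 (fun h' => Env G L h' ∧ h'.var .r = r ∧ h'.var .i = i ∧
      h'.var .j = j ∧ h'.var .k = k ∧
      LabelApprox G r (relaxedBefore i j (k + 1)) (labels n h')) h := by
  classical
  have hW' := hW
  unfold Fits at hW'
  have b1 := mul_add_lt i.isLt j.isLt
  have b2 := mul_add_lt i.isLt k.isLt
  have b3 := mul_add_lt j.isLt k.isLt
  have b4 := mul_add_lt j.isLt i.isLt
  have b5 := mul_add_lt k.isLt i.isLt
  have a1 := H.adj i j
  have a2 := H.adj i k
  have a3 := H.adj j k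
  -- With truncated subtraction this is nonzero exactly if `j k` is an edge and `i j`, `i k` are
  -- not.
  have ev : (.inp (2 + Var.j * Var.n + Var.k) - .inp (2 + Var.i * Var.n + Var.j)
      - .inp (2 + Var.i * Var.n + Var.k) : Expr).eval h =
      (if G.Adj j k then 1 else 0) - (if G.Adj i j then 1 else 0)
        - (if G.Adj i k then 1 else 0) := by
    simp [hi, hj, hk, H.var_n, a1, a2, a3]
  refine (Runs.ite (T := 150) ?_ (fun hne => ?_) (fun heq => ?_)).weaken (by decide)
  · simp [hi, hj, hk, H.var_n, a1, a2, a3, inputSize]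
    split_ifs <;> omega
  · rw [ev] at hne
    have c1 : G.Adj j k := by by_contra hc; simp [hc] at hne
    have c2 : ¬ G.Adj i j := by intro hc; simp [c1, hc] at hne
    have c3 : ¬ G.Adj i k := by intro hc; simp [c1, hc] at hne
    have d1 : Gᶜ.Adj i j := ⟨by rintro rfl; exact c3 c1, c2⟩
    have d2 : Gᶜ.Adj i k := ⟨by rintro rfl; exact c2 c1.symm, c3⟩
    refine (Runs.seq (T₁ := 70) (T₂ := 70) ((runs_relaxPair hW (p := (i, j)) (q := (i, k)) HA
      ⟨d1, d2, .inl ⟨rfl, c1⟩⟩ ?_ ?_ ?_ ?_ fun m HA' => ?_).weaken (by decide))).weaken (by decide)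
    · simp [hi, hj, H.var_n]
    · simp [hi, hk, H.var_n]
    · simp [hi, hj, H.var_n]; omega
    · simp [hi, hk, H.var_n]; omega
    · refine (runs_relaxPair hW (p := (j, i)) (q := (k, i)) HA'
        ⟨d1.symm, d2.symm, .inr ⟨rfl, c1⟩⟩ ?_ ?_ ?_ ?_ fun m' HA'' => ?_).weaken (by decide)
      · simp [hi, hj, H.var_n]
      · simp [hi, hk, H.var_n]
      · simp [hi, hj, H.var_n]; omega
      · simp [hi, hk, H.var_n]; omega
      · refine ⟨(H.setArr _ _ _).setArr _ _ _, hr, hi, hj, hk, HA''.mono fun p p' _ hp => ?_⟩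
        rcases relaxedBefore_succ hp with h | h | h
        · exact .inl (.inl h)
        · exact .inl (.inr h)
        · exact .inr h
  · refine (Runs.skip ?_).weaken (by omega)
    refine ⟨H, hr, hi, hj, hk, HA.mono fun p p' ha hp => ?_⟩
    rcases relaxedBefore_succ hp with h | h
    · exact h
    -- When the test fails, the two pairs added to `relaxedBefore` are not adjacent in the forcing
    -- graph, so nothing had to be relaxed.
    · exfalso
      rw [ev] at heq
      have key : Gᶜ.Adj i j ∧ Gᶜ.Adj i k ∧ G.Adj j k := by
        rcases h with ⟨rfl, rfl⟩ | ⟨rfl, rfl⟩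
        · obtain ⟨h1, h2, ⟨-, h⟩ | ⟨-, h⟩⟩ := ha
          · exact ⟨h1, h2, h⟩
          · exact absurd rfl h.ne
        · obtain ⟨h1, h2, ⟨-, h⟩ | ⟨-, h⟩⟩ := ha
          · exact absurd rfl h.ne
          · exact ⟨h1.symm, h2.symm, h⟩
      simp [key.2.2, key.1.2, key.2.1.2] at heq

/-- Iterate the relaxation until all labels are least. -/
def relaxAll : Prog :=
  forLoop .r .sq <| forLoop .i .n <| forLoop .j .n <| forLoop .k .n relaxTriple

/-- Each round visits all triples `(i, j, k)` and thereby relaxes every forcing edge, so it raises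
the radius of `LabelApprox` by one. -/
theorem runs_relaxAll {W : ℕ} (hW : Fits n s W) (H : Env G L h)
    (HA : LabelApprox G 0 (fun _ _ => False) (labels n h)) :
    Runs W (inputSize n s) relaxAll
      (n * n * (n * (n * (n * 208 + 6 + 8) + 6 + 8) + 6 + 8) + 6)
      (fun h' => Env G L h' ∧ IsMinLabel G (labels n h')) h := by
  have hW' := hW
  unfold Fits at hW'
  refine Runs.forLoop (n * n) (fun r h => h.var .r = r ∧ Env G L h ∧
    LabelApprox G r (fun _ _ => False) (labels n h)) (by omega) (fun r h hI => ⟨hI.1, hI.2.1.var_sq⟩)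
    ⟨by simp, H.set rfl 0, HA⟩ ?_ fun h hI => ⟨hI.2.1, hI.2.2.isMinLabel⟩
  rintro r - h ⟨hr, H, HA⟩
  refine Runs.forLoop n (fun i h => h.var .i = i ∧ h.var .r = r ∧ Env G L h ∧
    LabelApprox G r (relaxedBefore i 0 0) (labels n h)) (by omega)
    (fun r h hI => ⟨hI.1, hI.2.2.1.var_n⟩)
    ⟨by simp, by simpa using hr, H.set rfl 0,
      HA.mono fun p p' _ hp => relaxedBefore_zero hp⟩ ?_ ?_
  swap
  · rintro h ⟨-, hr, H, HA⟩
    exact ⟨hr, by simp, H.set rfl _, HA.succ fun p p' => relaxedBefore_of_adj⟩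
  rintro i hi h ⟨hi', hr, H, HA⟩
  refine Runs.forLoop n (fun j h => h.var .j = j ∧ h.var .i = i ∧ h.var .r = r ∧ Env G L h ∧
    LabelApprox G r (relaxedBefore i j 0) (labels n h)) (by omega)
    (fun r h hI => ⟨hI.1, hI.2.2.2.1.var_n⟩)
    ⟨by simp, by simpa using hi', by simpa using hr, H.set rfl 0, HA⟩ ?_ ?_
  swap
  · rintro h ⟨-, hi, hr, H, HA⟩
    exact ⟨hi, by simp, by simpa using hr, H.set rfl _,
      HA.mono fun p p' _ => relaxedBefore_next'⟩
  rintro j hj h ⟨hj', hi', hr, H, HA⟩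
  refine Runs.forLoop n (fun k h => h.var .k = k ∧ h.var .j = j ∧ h.var .i = i ∧ h.var .r = r ∧
    Env G L h ∧ LabelApprox G r (relaxedBefore i j k) (labels n h)) (by omega)
    (fun r h hI => ⟨hI.1, hI.2.2.2.2.1.var_n⟩)
    ⟨by simp, by simpa using hj', by simpa using hi', by simpa using hr, H.set rfl 0, HA⟩ ?_ ?_
  swap
  · rintro h ⟨-, hj, hi, hr, H, HA⟩
    exact ⟨hj, by simp, by simpa using hi, by simpa using hr, H.set rfl _,
      HA.mono fun p p' _ => relaxedBefore_next⟩
  rintro k hk h ⟨hk', hj', hi', hr, H, HA⟩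
  refine (runs_relaxTriple (i := ⟨i, hi⟩) (j := ⟨j, hj⟩) (k := ⟨k, hk⟩) hW H hr hi' hj' hk' HA).mono
    le_rfl ?_
  rintro h' ⟨H, hr, hi', hj', hk', HA⟩
  exact ⟨hk', by simp, by simpa using hj', by simpa using hi', by simpa using hr, H.set rfl _, HA⟩

end

end RAM

/-! ### Counting, degrees and ranks -/

namespace RAM

open SimpleGraph Function

theorem Store.set_set (h : Store) (x : Var) (a b : ℕ) : (h.set x a).set x b = h.set x b := by
  ext : 1 <;> try rfl
  funext y
  simp only [Store.set_var]
  split_ifs <;> rfl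

theorem Store.set_comm (h : Store) {x y : Var} (hxy : x ≠ y) (a b : ℕ) :
    (h.set x a).set y b = (h.set y b).set x a := by
  ext : 1 <;> try rfl
  funext z
  simp only [Store.set_var]
  split_ifs with h1 h2 <;> first | rfl | (subst h1; exact absurd h2.symm hxy)

variable {n s : ℕ} {G : SimpleGraph (Fin n)} {L : Fin n → Finset (Fin s)} {h : Store} {W : ℕ}

/-- Count in `acc` the indices `i < n` for which `e ≠ 0`. -/
def countLoop (e : Expr) : Prog :=
  .seq (assign .acc 0) <| forLoop .i .n <| ite e (assign .acc (Var.acc + 1)) .skip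

theorem runs_countLoop (hW : Fits n s W) (H : Env G L h) {e : Expr} (p : Fin n → Prop)
    [DecidablePred p]
    (he : ∀ (k : Fin n) (a : ℕ), e.Ok W (inputSize n s) ((h.set .acc a).set .i k) ∧
      (e.eval ((h.set .acc a).set .i k) ≠ 0 ↔ p k))
    {Q : Store → Prop}
    (hQ : Q ((h.set .acc (Finset.univ.filter p).card).set .i n)) :
    Runs W (inputSize n s) (countLoop e) (n * (e.cost + 13) + 8) Q h := by
  unfold Fits at hW
  refine (Runs.seq (T₁ := 2) (T₂ := n * (e.cost + 5 + 8) + 6) (Runs.assign (by simp) ?_)).weaken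
    (by ring_nf; omega)
  -- The invariant gives the store exactly: it is `h` except for `acc` and `i`. Hence `e` has to be
  -- understood only in stores of this form.
  refine Runs.forLoop n (fun i h' => h' = (h.set .acc
    (Finset.univ.filter fun k : Fin n => (k : ℕ) < i ∧ p k).card).set .i i) (by omega) ?_ ?_ ?_ ?_
  · rintro i _ rfl
    exact ⟨by simp, by simpa using H.var_n⟩
  · simp
  · rintro i hi _ rfl
    have hcard : (Finset.univ.filter fun k : Fin n => (k : ℕ) < i ∧ p k).card ≤ n :=
      (Finset.card_le_univ _).trans (by simp)
    obtain ⟨h1, h2⟩ := he ⟨i, hi⟩ (Finset.univ.filter fun k : Fin n => (k : ℕ) < i ∧ p k).card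
    refine (Runs.ite (T := 4) h1 (fun hne => ?_) (fun heq => ?_)).weaken le_rfl
    · refine (Runs.assign (by simp; omega) ⟨by simp, ?_⟩).weaken (by decide)
      have : (Finset.univ.filter fun k : Fin n => (k : ℕ) < i + 1 ∧ p k) =
          insert ⟨i, hi⟩ (Finset.univ.filter fun k : Fin n => (k : ℕ) < i ∧ p k) := by
        ext k
        simp only [Finset.mem_filter, Finset.mem_univ, true_and, Finset.mem_insert, Fin.ext_iff]
        constructor
        · rintro ⟨h3, h4⟩
          by_cases hk : (k : ℕ) = i
          · exact .inl hk
          · exact .inr ⟨by omega, h4⟩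
        · rintro (h3 | ⟨h3, h4⟩)
          · have : k = ⟨i, hi⟩ := Fin.ext h3
            subst this
            exact ⟨by simp, h2.1 hne⟩
          · exact ⟨by omega, h4⟩
      rw [this, Finset.card_insert_of_notMem (by simp)]
      simp only [Expr.eval_add, Expr.eval_var, Expr.eval_one, Store.set_var]
      rw [Store.set_comm _ (by decide), Store.set_set, Store.set_comm _ (by decide), Store.set_set]
      simp
    · refine (Runs.skip ⟨by simp, ?_⟩).weaken (by omega)
      rw [Store.set_set]
      have : (Finset.univ.filter fun k : Fin n => (k : ℕ) < i + 1 ∧ p k) =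
          (Finset.univ.filter fun k : Fin n => (k : ℕ) < i ∧ p k) := by
        ext k
        simp only [Finset.mem_filter, Finset.mem_univ, true_and]
        constructor
        · rintro ⟨h3, h4⟩
          refine ⟨?_, h4⟩
          by_contra h5
          have : k = ⟨i, hi⟩ := Fin.ext (by simp; omega)
          subst this
          exact h2.2 h4 heq
        · exact fun ⟨h3, h4⟩ => ⟨by omega, h4⟩
      rw [this]
  · rintro _ rfl
    simpa using hQ

/-- Compute the degrees of the lexicographic orientation. -/
def computeDegrees : Prog :=
  forLoop .j .n <| .seq
    (countLoop ((.arr .lab (Var.j * Var.n + Var.i) - .arr .lab (Var.i * Var.n + Var.j))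
      * (1 - .inp (2 + Var.i * Var.n + Var.j))))
    (putArr .deg Var.j Var.acc)

theorem runs_computeDegrees (hW : Fits n s W) (H : Env G L h)
    (hlab : IsMinLabel G (labels n h)) :
    Runs W (inputSize n s) computeDegrees (n * (n * 60 + 40) + 6)
      (fun h' => Env G L h' ∧ ∀ v : Fin n, h'.arr .deg v = lexDeg G (labels n h) v) h := by
  classical
  have hW' := hW
  unfold Fits at hW'
  refine (Runs.forLoop (T := n * 60 + 32) n (fun j h' => h'.var .j = j ∧ Env G L h' ∧
    h'.arr .lab = h.arr .lab ∧ ∀ v : Fin n, (v : ℕ) < j → h'.arr .deg v = lexDeg G (labels n h) v)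
    (by omega) (fun j h hI => ⟨hI.1, hI.2.1.var_n⟩) ⟨by simp, H.set rfl 0, rfl, by simp⟩ ?_ ?_)
  · rintro j hj h' ⟨hj', H', hl, hd⟩
    refine (Runs.seq (T₁ := n * 60 + 8) (T₂ := 20) ((runs_countLoop hW H'
      (fun u => LexDir G (labels n h) u ⟨j, hj⟩) (fun k a => ?_) ?_).weaken ?_)).weaken (by omega)
    · have b1 := mul_add_lt hj k.isLt
      have b2 := mul_add_lt k.isLt hj
      have lb : ∀ p : Fin n × Fin n, h.arr .lab (p.1 * n + p.2) < n * n := by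
        intro p
        obtain ⟨q, -, e⟩ := (hlab p).1
        have e' : h.arr .lab (p.1 * n + p.2) = _ := e
        rw [e']
        exact mul_add_lt q.1.isLt q.2.isLt
      have l1 := lb (⟨j, hj⟩, k)
      have l2 := lb (k, ⟨j, hj⟩)
      have a1 := H'.adj k ⟨j, hj⟩
      dsimp only at l1 l2 a1
      constructor
      · simp [hj', H'.var_n, a1, hl, inputSize]
        split_ifs <;> simp <;> omega
      · simp only [Expr.eval_mul, Expr.eval_sub, Expr.eval_arr, Expr.eval_add, Expr.eval_var,
          Expr.eval_inp, Expr.eval_one, Expr.eval_two, Store.set_var, Store.set_arr, Store.set_inp,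
          reduceCtorEq, if_false, if_true, hj', H'.var_n, a1, hl, LexDir, labels, compl_adj]
        by_cases hadj : G.Adj k ⟨j, hj⟩
        · simp [hadj]
        · simp only [hadj, if_false, Nat.sub_zero, mul_one, not_false_eq_true, and_true]
          constructor
          · intro hne
            refine ⟨?_, by omega⟩
            rintro rfl
            simp at hne
          · rintro ⟨-, hlt⟩
            omega
    · refine (Runs.putArr (by simp) (by simp) (by simp [hj', inputSize]; omega) ?_).weaken
        (by decide)
      refine ⟨by simp [hj'], by simp,
        ((((H'.set rfl _).set rfl _).setArr _ _ _).set rfl _), ?_, fun v hv => ?_⟩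
      · rw [Store.set_arr, Store.setArr_arr_of_ne _ _ _ (by decide)]
        exact hl
      · simp only [Store.set_arr, Store.setArr_arr, true_and, Expr.eval_var, Store.set_var,
          reduceCtorEq, if_false, if_true, hj']
        split_ifs with e
        · have : v = ⟨j, hj⟩ := Fin.ext e
          subst this
          rfl
        · exact hd v (by omega)
    · have : ((.arr .lab (Var.j * Var.n + Var.i) - .arr .lab (Var.i * Var.n + Var.j))
        * (1 - .inp (2 + Var.i * Var.n + Var.j)) : Expr).cost ≤ 47 := by decide
      have := Nat.mul_le_mul_left n (Nat.add_le_add_right this 13)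
      omega
  · exact fun h' hI => ⟨hI.2.1, fun v => hI.2.2.2 v v.isLt⟩

/-- Sort the vertices by their degrees. -/
def computeOrder : Prog :=
  forLoop .j .n <| .seq
    (countLoop ((.arr .deg Var.j * Var.n + Var.j) - (.arr .deg Var.i * Var.n + Var.i)))
    (putArr .ord Var.acc Var.j)

/-- The number of smaller keys is the rank of a vertex. Ranks are a bijection, so storing each
vertex at its rank inverts it. The bound `hf` keeps the keys within the word size. -/
theorem runs_computeOrder (hW : Fits n s W) (H : Env G L h) (f : Fin n → ℕ) (hf : ∀ v, f v ≤ n)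
    (hdeg : ∀ v : Fin n, h.arr .deg v = f v) :
    Runs W (inputSize n s) computeOrder (n * (n * 60 + 40) + 6)
      (fun h' => Env G L h' ∧ ∀ p : Fin n, h'.arr .ord p = sortEquiv f p) h := by
  have hW' := hW
  unfold Fits at hW'
  refine (Runs.forLoop (T := n * 60 + 32) n (fun j h' => h'.var .j = j ∧ Env G L h' ∧
    h'.arr .deg = h.arr .deg ∧ ∀ v : Fin n, (v : ℕ) < j → h'.arr .ord (sortRank f v) = v)
    (by omega) (fun j h hI => ⟨hI.1, hI.2.1.var_n⟩) ⟨by simp, H.set rfl 0, rfl, by simp⟩ ?_ ?_)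
  · rintro j hj h' ⟨hj', H', hl, hd⟩
    have d1 := hdeg ⟨j, hj⟩
    have f1 := Nat.mul_le_mul_right n (hf ⟨j, hj⟩)
    refine (Runs.seq (T₁ := n * 60 + 8) (T₂ := 20) ((runs_countLoop hW H'
      (fun u => f u * n + u < f ⟨j, hj⟩ * n + (⟨j, hj⟩ : Fin n)) (fun k a => ?_) ?_).weaken
        ?_)).weaken (by omega)
    · have d2 := hdeg k
      have f2 := Nat.mul_le_mul_right n (hf k)
      dsimp only at d1
      constructor
      · simp [hj', H'.var_n, hl, inputSize, d1, d2]
        omega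
      · simp [hj', H'.var_n, hl, d1, d2]
        omega
    · change Runs _ _ _ _ _ ((h'.set .acc (sortRank f ⟨j, hj⟩)).set .i n)
      have := sortRank_lt f ⟨j, hj⟩
      refine (Runs.putArr (by simp) (by simp) (by simp [inputSize]; omega) ?_).weaken
        (by decide)
      refine ⟨by simp [hj'], by simp,
        ((((H'.set rfl _).set rfl _).setArr _ _ _).set rfl _), ?_, fun v hv => ?_⟩
      · rw [Store.set_arr, Store.setArr_arr_of_ne _ _ _ (by decide)]
        exact hl
      · simp only [Store.set_arr, Store.setArr_arr, true_and, Expr.eval_var, Store.set_var,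
          reduceCtorEq, if_false, if_true, hj']
        split_ifs with e
        · rw [sortRank_injective f e]
        · refine hd v ?_
          by_contra hv'
          have : v = ⟨j, hj⟩ := Fin.ext (by simp; omega)
          exact e (by rw [this])
    · have : ((.arr .deg Var.j * Var.n + Var.j) - (.arr .deg Var.i * Var.n + Var.i) : Expr).cost
          ≤ 47 := by decide
      have := Nat.mul_le_mul_left n (Nat.add_le_add_right this 13)
      omega
  · refine fun h' hI => ⟨hI.2.1, fun p => ?_⟩
    have := hI.2.2.2 (sortEquiv f p) (Fin.isLt _)
    rwa [sortRank_sortEquiv] at this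

end RAM

/-! ### The dynamic program -/

namespace RAM

open SimpleGraph Function

variable {n s : ℕ} {G : SimpleGraph (Fin n)} {L : Fin n → Finset (Fin s)} {ord : Fin n ≃ Fin n}
  {h : Store} {W : ℕ}

theorem completable_succ_iff {t : Fin n} {k : ℕ} (hk : t + (k + 1) = n) {f : Fin s → Fin n} :
    Completable G L ord (k + 1) f ↔
      ∃ i, CanUse G L ord t f i ∧ Completable G L ord k (update f i t) := by
  constructor
  · rintro ⟨t', ht', h⟩
    have : t' = t := Fin.ext (by omega)
    rwa [this] at h
  · exact fun h => ⟨t, hk, h⟩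

/-- The abstract state `h` holds the instance and an enumeration of the vertices. -/
structure OrdEnv (G : SimpleGraph (Fin n)) (L : Fin n → Finset (Fin s)) (ord : Fin n ≃ Fin n)
    (h : Store) : Prop where
  env : Env G L h
  arr_ord : ∀ p : Fin n, h.arr .ord p = ord p

theorem OrdEnv.set (H : OrdEnv G L ord h) {x : Var} (hx : x.isParam = false) (a : ℕ) :
    OrdEnv G L ord (h.set x a) := ⟨H.env.set hx a, H.arr_ord⟩

theorem OrdEnv.setArr (H : OrdEnv G L ord h) {a : Arr} (ha : .ord ≠ a) (i v : ℕ) :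
    OrdEnv G L ord (h.setArr a i v) :=
  ⟨H.env.setArr _ _ _, by rw [Store.setArr_arr_of_ne _ _ _ ha]; exact H.arr_ord⟩

/-- The variables that the search for a color may change. -/
def Var.isScratch : Var → Bool
  | c | q | d | hit | col | next => true
  | _ => false

/-- `h` and `h'` differ in scratch variables only. -/
structure SameUpToScratch (h h' : Store) : Prop where
  var : ∀ x : Var, x.isScratch = false → h'.var x = h.var x
  arr : h'.arr = h.arr
  inp : h'.inp = h.inp

theorem SameUpToScratch.set {h h' : Store} (H : SameUpToScratch h h') {x : Var}
    (hx : x.isScratch = true) (a : ℕ) : SameUpToScratch h (h'.set x a) where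
  var y hy := by
    have : y ≠ x := by rintro rfl; rw [hx] at hy; cases hy
    rw [Store.set_var, if_neg this, H.var y hy]
  arr := H.arr
  inp := H.inp

theorem SameUpToScratch.ordEnv {h h' : Store} (H : SameUpToScratch h h') (E : OrdEnv G L ord h) :
    OrdEnv G L ord h' := by
  obtain ⟨E, ho⟩ := E
  refine ⟨⟨?_, ?_, ?_, ?_, ?_, ?_⟩, ?_⟩
  · rw [H.var _ rfl, E.var_n]
  · rw [H.var _ rfl, E.var_s]
  · rw [H.var _ rfl, E.var_sq]
  · rw [H.var _ rfl, E.var_pw]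
  · rw [H.inp]; exact E.adj
  · rw [H.inp]; exact E.lst
  · rw [H.arr]; exact ho

/-- The code of the state in which vertex `t` is the last vertex of color `c`. -/
def nextExpr : Expr := Var.st - Var.d * Var.q + Var.t * Var.q

/-- Whether vertex `t` can get color `c`, and the remaining vertices can then be colored. -/
def goodExpr : Expr :=
  .inp (2 + Var.n * Var.n + .arr .ord Var.t * Var.s + Var.c)
    * ((1 - (Var.n - 1 - Var.d)) + (1 - .inp (2 + .arr .ord Var.d * Var.n + .arr .ord Var.t)))
    * .arr .tab ((Var.t + 1) * Var.pw + nextExpr)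

/-- Search a color `col` for vertex `t` in state `st` that allows to complete the coloring. -/
def findColor : Prog :=
  .seq (assign .hit 0) <| .seq (assign .q 1) <| forLoop .c .s <|
    .seq (assign .d (Var.st / Var.q % Var.n)) <|
    .seq (ite goodExpr
      (.seq (assign .hit 1) <| .seq (assign .col Var.c) (assign .next nextExpr)) .skip)
    (assign .q (Var.q * Var.n))

-- Since `q` runs through the powers of `n`, digit `c` of the state is `st / q % n`. The search does
-- not stop at a hit; a later hit overwrites an earlier one, and any of them will do.
open Classical in
theorem runs_findColor (hn : 1 ≤ n) (hW : Fits n s W) (H : OrdEnv G L ord h) {t : Fin n}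
    {f : Fin s → Fin n} {k : ℕ} (ht : h.var .t = t) (hst : h.var .st = stateCode f)
    (htab : ∀ f : Fin s → Fin n, h.arr .tab ((t + 1) * n ^ s + stateCode f) =
      if Completable G L ord k f then 1 else 0) :
    Runs W (inputSize n s) findColor (s * 150 + 20) (fun h' => SameUpToScratch h h' ∧
      ((h'.var .hit = 1 ∧ ∃ i : Fin s, CanUse G L ord t f i ∧
          Completable G L ord k (update f i t) ∧ h'.var .col = i ∧
          h'.var .next = stateCode (update f i t)) ∨
        (h'.var .hit = 0 ∧ ∀ i : Fin s, ¬ (CanUse G L ord t f i ∧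
          Completable G L ord k (update f i t))))) h := by
  have hW' := hW
  unfold Fits at hW'
  have hpw : (n + 2) * n ^ s = (n + 1) * n ^ s + n ^ s := by ring
  have hpw1 : 1 ≤ n ^ s := Nat.one_le_pow _ _ hn
  have hpw2 : n ^ s ≤ (n + 1) * n ^ s := Nat.le_mul_of_pos_left _ (by omega)
  refine Runs.weaken (T := 2 + (2 + (s * 150 + 6))) (Runs.seq (Runs.assign (by simp) ?_)) (by omega)
  refine Runs.seq (Runs.assign (by simp; omega) ?_)
  refine (Runs.forLoop (T := 140) s (fun c h' => h'.var .c = c ∧ SameUpToScratch h h' ∧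
    h'.var .q = n ^ c ∧
      ((h'.var .hit = 1 ∧ ∃ i : Fin s, CanUse G L ord t f i ∧
          Completable G L ord k (update f i t) ∧ h'.var .col = i ∧
          h'.var .next = stateCode (update f i t)) ∨
        (h'.var .hit = 0 ∧ ∀ i : Fin s, (i : ℕ) < c → ¬ (CanUse G L ord t f i ∧
          Completable G L ord k (update f i t))))) ?_ ?_ ?_ ?_ ?_).weaken (by omega)
  · have := Nat.le_mul_of_pos_left s hn
    omega
  · exact fun i h' hI => ⟨hI.1, (hI.2.1.ordEnv H).env.var_s⟩
  · refine ⟨by simp, ?_, by simp, .inr ⟨by simp, by simp⟩⟩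
    exact (SameUpToScratch.set (SameUpToScratch.set (SameUpToScratch.set ⟨fun _ _ => rfl, rfl, rfl⟩
      rfl _) rfl _) rfl _)
  · rintro c hc h' ⟨hc', S, hq, hI⟩
    have H' := S.ordEnv H
    have E := H'.env
    have ht' : h'.var .t = t := by rw [S.var _ rfl, ht]
    have hst' : h'.var .st = stateCode f := by rw [S.var _ rfl, hst]
    have dig : stateCode f / n ^ c % n = f ⟨c, hc⟩ := stateCode_digit f ⟨c, hc⟩
    have b1 := stateCode_lt f
    have b2 : stateCode f / n ^ c ≤ stateCode f := Nat.div_le_self _ _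
    have b3 : (f ⟨c, hc⟩ : ℕ) * n ^ c ≤ stateCode f := digit_mul_le_stateCode f ⟨c, hc⟩
    have b4 : n ^ c * n ≤ n ^ s := by
      rw [← pow_succ]; exact Nat.pow_le_pow_right hn hc
    have b5 : (t : ℕ) * n ^ c ≤ n ^ s :=
      (by rw [mul_comm]; exact Nat.mul_le_mul_left _ t.isLt.le : (t : ℕ) * n ^ c ≤ n ^ c * n).trans
        b4
    have b6 := stateCode_lt (update f ⟨c, hc⟩ t)
    have upd : stateCode (update f ⟨c, hc⟩ t) =
      stateCode f - f ⟨c, hc⟩ * n ^ c + t * n ^ c := stateCode_update f ⟨c, hc⟩ t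
    have b7 := mul_add_lt (show (t : ℕ) + 1 < n + 1 by omega) b6
    have b8 := mul_add_lt (ord t).isLt hc
    have b9 := mul_add_lt (ord (f ⟨c, hc⟩)).isLt (ord t).isLt
    have b10 := (f ⟨c, hc⟩).isLt
    have a1 := E.lst (ord t) ⟨c, hc⟩
    have a2 := E.adj (ord (f ⟨c, hc⟩)) (ord t)
    have a3 := htab (update f ⟨c, hc⟩ t)
    rw [← S.arr] at a3
    have a4 := H'.arr_ord t
    have a5 := H'.arr_ord (f ⟨c, hc⟩)
    dsimp only at a1
    rw [upd] at a3 b6 b7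
    have ev : goodExpr.eval (h'.set .d (f ⟨c, hc⟩)) =
        (if ⟨c, hc⟩ ∈ L (ord t) then 1 else 0) * ((1 - (n - 1 - f ⟨c, hc⟩)) +
          (1 - if G.Adj (ord (f ⟨c, hc⟩)) (ord t) then 1 else 0)) *
          (if Completable G L ord k (update f ⟨c, hc⟩ t) then 1 else 0) := by
      simp [goodExpr, nextExpr, hc', ht', hst', hq, E.var_n, E.var_s, E.var_pw, a1, a2, a3, a4, a5]
    have evn : nextExpr.eval (h'.set .d (f ⟨c, hc⟩)) = stateCode (update f ⟨c, hc⟩ t) := by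
      simp [nextExpr, ht', hst', hq, upd]
    -- Products act as conjunctions and sums as disjunctions. The term `1 - (n - 1 - d)` is nonzero
    -- exactly if the digit `d < n` is the default `n - 1`.
    have good : goodExpr.eval (h'.set .d (f ⟨c, hc⟩)) ≠ 0 ↔
        CanUse G L ord t f ⟨c, hc⟩ ∧ Completable G L ord k (update f ⟨c, hc⟩ t) := by
      rw [ev, CanUse]
      by_cases h1 : ⟨c, hc⟩ ∈ L (ord t) <;>
        by_cases h2 : Completable G L ord k (update f ⟨c, hc⟩ t) <;>
        by_cases h3 : G.Adj (ord (f ⟨c, hc⟩)) (ord t) <;> simp [h1, h2, h3]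
      omega
    have okn : nextExpr.Ok W (inputSize n s) (h'.set .d (f ⟨c, hc⟩)) := by
      simp [nextExpr, ht', hst', hq]
      omega
    have okg : goodExpr.Ok W (inputSize n s) (h'.set .d (f ⟨c, hc⟩)) := by
      refine ⟨⟨?_, ?_, ?_⟩, ⟨⟨?_, okn, ?_⟩, ?_⟩, ?_⟩
      · simp [hc', ht', E.var_n, E.var_s, a4, inputSize]
        omega
      · simp [ht', E.var_n, a2, a4, a5, inputSize]
        split_ifs <;> omega
      · simp [Op.eval, Expr.eval, hc', ht', E.var_n, E.var_s, a1, a2, a4, a5]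
        split_ifs <;> omega
      · simp [ht', E.var_pw]
        omega
      · simp [Op.eval, Expr.eval, ht', E.var_pw, evn, upd]
        omega
      · simp [Op.eval, Expr.eval, ht', E.var_pw, evn, upd, inputSize]
        omega
      · change goodExpr.eval (h'.set .d (f ⟨c, hc⟩)) ≤ W
        rw [ev]
        split_ifs <;> omega
    refine (Runs.seq (T₁ := 6) (T₂ := 130) ((Runs.assign ?_ ?_).weaken (by decide))).weaken
      (by omega)
    · simp [hst', hq, E.var_n, dig]
      omega
    have edig : (Var.st / Var.q % Var.n : Expr).eval h' = f ⟨c, hc⟩ := by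
      simp [hst', hq, E.var_n, dig]
    rw [edig]
    -- Both branches of the test end with the update of `q`, which is treated once for all.
    have last : ∀ h'' : Store, h''.var .c = c → SameUpToScratch h h'' → h''.var .q = n ^ c →
        ((h''.var .hit = 1 ∧ ∃ i : Fin s, CanUse G L ord t f i ∧
          Completable G L ord k (update f i t) ∧ h''.var .col = i ∧
          h''.var .next = stateCode (update f i t)) ∨
        (h''.var .hit = 0 ∧ ∀ i : Fin s, (i : ℕ) < c + 1 → ¬ (CanUse G L ord t f i ∧
          Completable G L ord k (update f i t)))) →
        Runs W (inputSize n s) (assign .q (Var.q * Var.n)) 4 (fun h' => h'.var .c = c ∧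
          (h'.set .c (c + 1)).var .c = c + 1 ∧ SameUpToScratch h (h'.set .c (c + 1)) ∧
          (h'.set .c (c + 1)).var .q = n ^ (c + 1) ∧
          (((h'.set .c (c + 1)).var .hit = 1 ∧ ∃ i : Fin s, CanUse G L ord t f i ∧
            Completable G L ord k (update f i t) ∧ (h'.set .c (c + 1)).var .col = i ∧
            (h'.set .c (c + 1)).var .next = stateCode (update f i t)) ∨
          ((h'.set .c (c + 1)).var .hit = 0 ∧ ∀ i : Fin s, (i : ℕ) < c + 1 →
            ¬ (CanUse G L ord t f i ∧ Completable G L ord k (update f i t))))) h'' := by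
      intro h'' hc'' S'' hq'' hI''
      have E'' := (S''.ordEnv H).env
      refine (Runs.assign ?_ ?_).weaken (by decide)
      · simp [hq'', E''.var_n]
        omega
      · refine ⟨by simpa using hc'', by simp, (S''.set rfl _).set rfl _, ?_, by simpa using hI''⟩
        simp [hq'', E''.var_n, pow_succ]
    refine Runs.seq (T₁ := 126) (T₂ := 4) ((Runs.ite (T := 15) okg (fun hne => ?_)
      (fun heq => ?_)).weaken (by decide))
    · refine Runs.seq (T₁ := 2) (T₂ := 13) (Runs.assign (by simp; omega) ?_)
      refine Runs.seq (T₁ := 2) (T₂ := 11) (Runs.assign (by simp) ?_)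
      refine (Runs.assign ?_ ?_).weaken (by decide)
      · simp [nextExpr, ht', hst', hq]
        omega
      · refine last _ (by simpa using hc')
          ((((S.set rfl _).set rfl _).set rfl _).set rfl _) (by simpa using hq) (.inl ⟨by simp, ?_⟩)
        obtain ⟨g1, g2⟩ := good.1 hne
        exact ⟨⟨c, hc⟩, g1, g2, by simp [hc'], by simp [nextExpr, ht', hst', hq, upd]⟩
    · refine (Runs.skip (last _ (by simpa using hc') (S.set rfl _) (by simpa using hq) ?_)).weaken
        (by omega)
      rcases hI with ⟨hI1, hI2⟩ | ⟨hI1, hI2⟩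
      · exact .inl ⟨by simpa using hI1, by simpa using hI2⟩
      · refine .inr ⟨by simpa using hI1, fun i hi => ?_⟩
        by_cases hic : (i : ℕ) = c
        · have : i = ⟨c, hc⟩ := Fin.ext hic
          subst this
          exact fun hg => good.2 hg heq
        · exact hI2 i (by omega)
  · rintro h' ⟨-, S, -, hI⟩
    refine ⟨S, hI.imp id fun ⟨h1, h2⟩ => ⟨h1, fun i => h2 i i.isLt⟩⟩

end RAM

/-! ### Filling the table and reading off a coloring -/

namespace RAM

open SimpleGraph Function

variable {n s : ℕ} {G : SimpleGraph (Fin n)} {L : Fin n → Finset (Fin s)} {ord : Fin n ≃ Fin n}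
  {h : Store} {W : ℕ}

open Classical in
/-- The layers of the table from `m` on are correct. -/
def TableFrom (G : SimpleGraph (Fin n)) (L : Fin n → Finset (Fin s)) (ord : Fin n ≃ Fin n) (m : ℕ)
    (h : Store) : Prop :=
  ∀ u, m ≤ u → u ≤ n → ∀ f : Fin s → Fin n, h.arr .tab (u * n ^ s + stateCode f) =
    if Completable G L ord (n - u) f then 1 else 0

theorem tabIndex_injective {u v : ℕ} {f g : Fin s → Fin n}
    (e : u * n ^ s + stateCode f = v * n ^ s + stateCode g) : u = v ∧ f = g := by
  have hf := stateCode_lt f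
  have hg := stateCode_lt g
  have huv : u = v := by
    rcases lt_trichotomy u v with h | h | h
    · have := mul_add_lt h hf; omega
    · exact h
    · have := mul_add_lt h hg; omega
  subst huv
  exact ⟨rfl, stateCode_injective (by omega)⟩

/-- The last layer of the table. -/
def initTable : Prog := forLoop .st .pw (putArr .tab (Var.n * Var.pw + Var.st) 1)

/-- The table has layers `0` to `n` of `n ^ s` entries each; the factor 8 is the stride of the
arrays. -/
theorem Fits.table (hn : 1 ≤ n) (hW : Fits n s W) :
    inputSize n s + 8 * ((n + 1) * n ^ s) + 100 ≤ W ∧ n ^ s ≤ (n + 1) * n ^ s ∧ 1 ≤ n ^ s ∧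
      n ≤ W ∧ s ≤ W := by
  unfold Fits at hW
  have hpw : (n + 2) * n ^ s = (n + 1) * n ^ s + n ^ s := by ring
  have hpw1 : 1 ≤ n ^ s := Nat.one_le_pow _ _ hn
  have hpw2 : n ^ s ≤ (n + 1) * n ^ s := Nat.le_mul_of_pos_left _ (by omega)
  have := Nat.le_mul_of_pos_left s hn
  dsimp only [inputSize]
  omega

theorem runs_initTable (hn : 1 ≤ n) (hW : Fits n s W) (H : OrdEnv G L ord h) :
    Runs W (inputSize n s) initTable (n ^ s * 30 + 6)
      (fun h' => OrdEnv G L ord h' ∧ TableFrom G L ord n h') h := by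
  obtain ⟨w1, w2, w3, w4, w5⟩ := hW.table hn
  refine Runs.forLoop (T := 22) (n ^ s) (fun i h' => h'.var .st = i ∧ OrdEnv G L ord h' ∧
    ∀ a < i, h'.arr .tab (n * n ^ s + a) = 1) (by omega)
    (fun i h hI => ⟨hI.1, hI.2.1.env.var_pw⟩) ⟨by simp, H.set rfl _, by simp⟩ ?_ ?_
  · rintro i hi h' ⟨hi', H', hI⟩
    have b := mul_add_lt (Nat.lt_succ_self n) hi
    rw [Nat.succ_eq_add_one] at b
    dsimp only [inputSize] at *
    refine (Runs.putArr (by simp; omega) ?_ ?_ ?_).weaken (by decide)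
    · simp [H'.env.var_n, H'.env.var_pw, hi']; omega
    · simp [H'.env.var_n, H'.env.var_pw, hi']; omega
    · refine ⟨by simpa using hi', by simp, (H'.setArr (by decide) _ _).set rfl _, fun a ha => ?_⟩
      simp only [Store.set_arr, Store.setArr_arr, Expr.eval_add, Expr.eval_mul, Expr.eval_var,
        H'.env.var_n, H'.env.var_pw, hi', true_and, Expr.eval_one]
      split_ifs with e
      · rfl
      · exact hI a (by omega)
  · rintro h' ⟨-, H', hI⟩
    refine ⟨H', fun u hu hu' f => ?_⟩
    have : u = n := by omega
    subst this
    rw [hI _ (stateCode_lt f), Nat.sub_self]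
    simp [Completable]

/-- Fill the other layers of the table, starting with the last one. -/
def fillTable : Prog :=
  forLoop .r .n <| .seq (assign .t (Var.n - 1 - Var.r)) <| forLoop .st .pw <|
    .seq findColor (putArr .tab (Var.t * Var.pw + Var.st) Var.hit)

/-- Layers are filled from `t = n - 1` downwards, because an entry of layer `t` depends on layer `t
+ 1` only. All codes below `n ^ s` are treated, whether or not they arise from a partial coloring.
-/
theorem runs_fillTable (hn : 1 ≤ n) (hW : Fits n s W) (H : OrdEnv G L ord h)
    (hT : TableFrom G L ord n h) :
    Runs W (inputSize n s) fillTable (n * (n ^ s * (s * 150 + 60) + 40) + 6)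
      (fun h' => OrdEnv G L ord h' ∧ TableFrom G L ord 0 h') h := by
  classical
  obtain ⟨w1, w2, w3, w4, w5⟩ := hW.table hn
  refine Runs.forLoop (T := n ^ s * (s * 150 + 60) + 32) n (fun r h' => h'.var .r = r ∧
    OrdEnv G L ord h' ∧ TableFrom G L ord (n - r) h') w4
    (fun i h hI => ⟨hI.1, hI.2.1.env.var_n⟩) ⟨by simp, H.set rfl _, hT⟩ ?_ ?_
  swap
  · rintro h' ⟨-, H', hI⟩
    exact ⟨H', by rwa [Nat.sub_self] at hI⟩
  rintro r hr h' ⟨hr', H', hI⟩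
  obtain ⟨t, ht⟩ : ∃ t : Fin n, (t : ℕ) = n - 1 - r := ⟨⟨n - 1 - r, by omega⟩, rfl⟩
  refine Runs.weaken (T := 6 + (n ^ s * (s * 150 + 52 + 8) + 6)) (Runs.seq (Runs.assign ?_ ?_))
    (by ring_nf; omega)
  · simp [hr', H'.env.var_n]; omega
  have et : (Var.n - 1 - Var.r : Expr).eval h' = t := by simp [hr', H'.env.var_n, ht]
  rw [et]
  refine Runs.forLoop (n ^ s) (fun i h' => h'.var .st = i ∧ h'.var .t = t ∧ h'.var .r = r ∧
    OrdEnv G L ord h' ∧ TableFrom G L ord (t + 1) h' ∧ ∀ f : Fin s → Fin n, stateCode f < i →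
      h'.arr .tab (t * n ^ s + stateCode f) = if Completable G L ord (n - t) f then 1 else 0)
    (by omega) (fun i h hI => ⟨hI.1, hI.2.2.2.1.env.var_pw⟩)
    ⟨by simp, by simp, by simpa using hr', (H'.set rfl _).set rfl _, ?_, by simp⟩ ?_ ?_
  · have : n - r = t + 1 := by omega
    rw [this] at hI
    exact hI
  swap
  · rintro h'' ⟨-, ht'', hr'', H'', h1, h2⟩
    refine ⟨hr'', by simp, H''.set rfl _, fun u hu hu' f => ?_⟩
    rcases Nat.lt_or_ge (t : ℕ) u with hlt | hge
    · exact h1 u hlt hu' f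
    · have : u = t := by omega
      subst this
      exact h2 f (stateCode_lt f)
  rintro i hi h'' ⟨hst'', ht'', hr'', H'', h1, h2⟩
  obtain ⟨f, rfl⟩ := exists_stateCode_eq hi
  refine Runs.weaken (T := (s * 150 + 20) + 20) (Runs.seq
    ((runs_findColor (k := n - (t + 1)) hn hW H'' ht'' hst'' (h1 (t + 1) le_rfl (by omega))).mono
      le_rfl ?_)) (by omega)
  rintro h₃ ⟨S, hres⟩
  have H₃ := S.ordEnv H''
  have ht₃ : h₃.var .t = t := by rw [S.var _ rfl, ht'']
  have hst₃ : h₃.var .st = stateCode f := by rw [S.var _ rfl, hst'']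
  have b := mul_add_lt (show (t : ℕ) < n + 1 by omega) hi
  have hit : h₃.var .hit = if Completable G L ord (n - t) f then 1 else 0 := by
    have e : n - t = (n - (t + 1)) + 1 := by omega
    rw [e, completable_succ_iff (t := t) (by omega)]
    rcases hres with ⟨h5, i, h6, h7, -⟩ | ⟨h5, h6⟩
    · rw [if_pos ⟨i, h6, h7⟩, h5]
    · rw [if_neg fun ⟨i, hi⟩ => h6 i hi, h5]
  dsimp only [inputSize] at *
  refine (Runs.putArr (by simp) ?_ ?_ ?_).weaken (by decide)
  · simp [ht₃, H₃.env.var_pw, hst₃]; omega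
  · simp [ht₃, H₃.env.var_pw, hst₃]; omega
  have ea : (Var.t * Var.pw + Var.st : Expr).eval h₃ = t * n ^ s + stateCode f := by
    simp [ht₃, H₃.env.var_pw, hst₃]
  have read : ∀ (m u : ℕ) (g : Fin s → Fin n),
      ((h₃.setArr .tab (t * n ^ s + stateCode f) (h₃.var .hit)).set .st m).arr .tab
        (u * n ^ s + stateCode g) = if u = t ∧ g = f then h₃.var .hit
          else h''.arr .tab (u * n ^ s + stateCode g) := by
    intro m u g
    simp only [Store.set_arr, Store.setArr_arr, true_and, S.arr]
    by_cases hu : u = t ∧ g = f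
    · rw [if_pos (by rw [hu.1, hu.2]), if_pos hu]
    · rw [if_neg fun e => hu (tabIndex_injective e), if_neg hu]
  rw [ea]
  refine ⟨by simpa using hst₃, by simp, by simpa using ht₃, ?_,
    (H₃.setArr (by decide) _ _).set rfl _, fun u hu hu' g => ?_, fun g hg => ?_⟩
  · simpa [S.var .r rfl] using hr''
  · rw [Expr.eval_var, read, if_neg (by omega)]
    exact h1 u hu hu' g
  · rw [Expr.eval_var, read]
    split_ifs with e hc hc
    · rw [hit, ← e.2, if_pos hc]
    · rw [hit, ← e.2, if_neg hc]
    · rw [h2 g ?_, if_pos hc]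
      have : stateCode g ≠ stateCode f := fun h => e ⟨rfl, stateCode_injective h⟩
      omega
    · rw [h2 g ?_, if_neg hc]
      have : stateCode g ≠ stateCode f := fun h => e ⟨rfl, stateCode_injective h⟩
      omega

/-- Color the vertices one by one. -/
def colorVertices : Prog :=
  forLoop .t .n <| .seq findColor <| .seq (putArr .out (.arr .ord Var.t) Var.col)
    (assign .st Var.next)

/-- The invariant is a partial coloring of the first `t` positions whose state can still be
completed. The table keeps the greedy choice from running into a dead end. -/
theorem runs_colorVertices (hn : 1 ≤ n) (hs : 1 ≤ s) (hW : Fits n s W) (H : OrdEnv G L ord h)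
    (hord : IsComparabilityOrdering Gᶜ ord) (hT : TableFrom G L ord 0 h)
    (hst : h.var .st = n ^ s - 1)
    (hC : Completable G L ord n (fun _ => ⟨n - 1, by omega⟩)) :
    Runs W (inputSize n s) colorVertices (n * (s * 150 + 60) + 6)
      (fun h' => h'.var .ans = h.var .ans ∧ h'.var .n = n ∧ ∃ c : G.Coloring (Fin s),
        IsListColoring G L c ∧ ∀ v : Fin n, h'.arr .out v = c v) h := by
  obtain ⟨w1, w2, w3, w4, w5⟩ := hW.table hn
  refine Runs.forLoop (T := s * 150 + 52) n (fun t h' => h'.var .t = t ∧ OrdEnv G L ord h' ∧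
    h'.var .ans = h.var .ans ∧ TableFrom G L ord 0 h' ∧ ∃ f c, h'.var .st = stateCode f ∧
      PartialColoring G L ord t f c ∧ Completable G L ord (n - t) f ∧
      ∀ p : Fin n, (p : ℕ) < t → h'.arr .out (ord p) = c p) w4
    (fun i h hI => ⟨hI.1, hI.2.1.env.var_n⟩)
    ⟨by simp, H.set rfl _, by simp, hT, _, fun _ => ⟨0, hs⟩,
      by simpa [stateCode_const_last hn] using hst, partialColoring_zero hn _, hC, by simp⟩ ?_ ?_
  · rintro t ht h' ⟨ht', H', ha, hT', f, c, hst', hP, hC', ho⟩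
    obtain ⟨t, rfl⟩ : ∃ t' : Fin n, (t' : ℕ) = t := ⟨⟨t, ht⟩, rfl⟩
    refine Runs.weaken (T := (s * 150 + 20) + 20) (Runs.seq
      ((runs_findColor (k := n - (t + 1)) hn hW H' ht' hst'
        (hT' (t + 1) (by omega) (by omega))).mono le_rfl ?_)) (by omega)
    rintro h₃ ⟨S, hres⟩
    have H₃ := S.ordEnv H'
    have ht₃ : h₃.var .t = t := by rw [S.var _ rfl, ht']
    have e : n - t = (n - (t + 1)) + 1 := by omega
    rw [e, completable_succ_iff (t := t) (by omega)] at hC'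
    -- The search cannot fail, as the current state is completable.
    obtain ⟨-, i, h6, h7, h8, h9⟩ := hres.resolve_right fun h => h.2 _ hC'.choose_spec
    have b1 := (ord t).isLt
    unfold Fits at hW
    dsimp only [inputSize] at *
    refine (Runs.seq (T₁ := 14) (T₂ := 2) (Runs.weaken (Runs.putArr (by simp) ?_ ?_ ?_)
      (by decide))).weaken (by omega)
    · simp [ht₃]; omega
    · simp [ht₃, H₃.arr_ord]; omega
    refine (Runs.assign (by simp) ?_)
    refine ⟨by simpa using ht₃, by simp, ((H₃.setArr (by decide) _ _).set rfl _).set rfl _,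
      by simpa [S.var .ans rfl] using ha, ?_, update f i t, update c t i, by simpa using h9,
      hP.step hord h6, h7, fun p hp => ?_⟩
    · intro u hu hu' g
      have := hT' u hu hu' g
      rw [← S.arr] at this
      rw [← this, Store.set_arr, Store.set_arr, Store.setArr_arr_of_ne _ _ _ (by decide)]
    · simp only [Store.set_arr, Store.setArr_arr, true_and, Expr.eval_arr, Expr.eval_var, ht₃,
        H₃.arr_ord, h8]
      rcases eq_or_ne p t with rfl | hpt
      · simp
      · rw [update_of_ne hpt, if_neg fun h => hpt (ord.injective (Fin.ext h)), S.arr]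
        exact ho p (by have := Fin.val_ne_of_ne hpt; omega)
  · rintro h' ⟨-, H', ha, -, f, c, -, hP, -, ho⟩
    obtain ⟨c', hc', e⟩ := hP.exists_isListColoring
    refine ⟨ha, H'.env.var_n, c', hc', fun v => ?_⟩
    have := ho (ord.symm v) (Fin.isLt _)
    rwa [Equiv.apply_symm_apply, ← e v] at this

/-- Copy the coloring to the beginning of the memory. -/
def copyOutput : Prog := forLoop .t .n (putInp Var.t (.arr .out Var.t))

/-- The answer goes where the input was, and the adjacency matrix is read until the last vertex is
colored. This is why the colors are first collected in `out`. -/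
theorem runs_copyOutput (hW : Fits n s W) (hvn : h.var .n = n) :
    Runs W (inputSize n s) copyOutput (n * 20 + 6)
      (fun h' => h'.var .ans = h.var .ans ∧ ∀ v < n, h'.inp v = h.arr .out v) h := by
  unfold Fits at hW
  refine Runs.forLoop (T := 12) n (fun t h' => h'.var .t = t ∧ h'.var .n = n ∧
    h'.var .ans = h.var .ans ∧ h'.arr = h.arr ∧ ∀ v < t, h'.inp v = h.arr .out v) (by omega)
    (fun i h hI => ⟨hI.1, hI.2.1⟩) ⟨by simp, by simpa using hvn, by simp, rfl, by simp⟩ ?_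
    fun h' hI => ⟨hI.2.2.1, hI.2.2.2.2⟩
  rintro t ht h' ⟨ht', hn', ha, harr, hi⟩
  have hlt : t < inputSize n s := by
    have := Nat.le_mul_of_pos_left n (show 0 < n by omega)
    dsimp only [inputSize]
    omega
  refine (Runs.putInp (by simp [ht', inputSize]; omega) (by simp) (by simpa [ht'] using hlt)
    ?_).weaken (by decide)
  refine ⟨by simpa using ht', by simp, by simpa using hn', by simpa using ha, harr, fun v hv => ?_⟩
  simp only [Store.set_inp, Store.setInp_inp, Expr.eval_var, Expr.eval_arr, ht', harr]
  split_ifs with e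
  · rw [e]
  · exact hi v (by omega)

/-- The dynamic program for a given enumeration of the vertices. -/
def solveOrdered : Prog :=
  .seq initTable <| .seq fillTable <| .seq (assign .st (Var.pw - 1)) <|
  ite (.arr .tab Var.st) (.seq (assign .ans 1) (.seq colorVertices copyOutput)) (assign .ans 0)

theorem runs_solveOrdered (hn : 1 ≤ n) (hs : 1 ≤ s) (hW : Fits n s W) (H : OrdEnv G L ord h)
    (hord : IsComparabilityOrdering Gᶜ ord) :
    Runs W (inputSize n s) solveOrdered
      (n ^ s * 30 + n * (n ^ s * (s * 150 + 60) + 40) + n * (s * 150 + 80) + 60)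
      (fun h' => (h'.var .ans = 0 ∧ ¬ ∃ c : G.Coloring (Fin s), IsListColoring G L c) ∨
        (h'.var .ans = 1 ∧ ∃ c : G.Coloring (Fin s), IsListColoring G L c ∧
          ∀ v : Fin n, h'.inp v = c v)) h := by
  classical
  obtain ⟨w1, w2, w3, w4, w5⟩ := hW.table hn
  refine Runs.weaken (T := (n ^ s * 30 + 6) + ((n * (n ^ s * (s * 150 + 60) + 40) + 6) +
    (4 + (n * (s * 150 + 80) + 40)))) (Runs.seq ((runs_initTable hn hW H).mono le_rfl ?_))
    (by omega)
  rintro h₁ ⟨H₁, T₁⟩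
  refine Runs.seq ((runs_fillTable hn hW H₁ T₁).mono le_rfl ?_)
  rintro h₂ ⟨H₂, T₂⟩
  refine Runs.seq (Runs.weaken (Runs.assign (by simp [H₂.env.var_pw]; omega) ?_) (by decide))
  have e : (Var.pw - 1 : Expr).eval h₂ = n ^ s - 1 := by simp [H₂.env.var_pw]
  rw [e]
  have tab0 := T₂ 0 le_rfl (by omega) (fun _ => ⟨n - 1, by omega⟩)
  rw [zero_mul, zero_add, stateCode_const_last hn, Nat.sub_zero] at tab0
  refine Runs.weaken (T := 7 + ((n * (s * 150 + 80) + 30) + 1)) (Runs.ite ?_ (fun hne => ?_)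
    (fun heq => ?_)) (by omega)
  · simp; omega
  · have hC : Completable G L ord n (fun _ => ⟨n - 1, by omega⟩) := by
      by_contra hC
      simp [tab0, hC] at hne
    refine Runs.weaken (T := 2 + ((n * (s * 150 + 60) + 6) + (n * 20 + 6)))
      (Runs.seq (Runs.assign (by simp; omega) ?_)) (by ring_nf; omega)
    refine Runs.seq ((runs_colorVertices hn hs hW ((H₂.set rfl _).set rfl _) hord T₂ (by simp)
      hC).mono le_rfl ?_)
    rintro h₃ ⟨ha, hn', c, hc, ho⟩
    refine (runs_copyOutput hW hn').mono le_rfl ?_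
    rintro h₄ ⟨ha', hi⟩
    exact .inr ⟨by rw [ha', ha]; simp, c, hc, fun v => by rw [hi v v.isLt, ho v]⟩
  · refine (Runs.assign (by simp) (.inl ⟨by simp, ?_⟩)).weaken
      (by rw [show (0 : Expr).cost + 1 = 2 from rfl]; omega)
    rintro ⟨c, hc⟩
    have := completable_of_isListColoring hn hord hc
    simp [tab0, this] at heq

end RAM

/-! ### The complete program -/

namespace RAM

open SimpleGraph Function

variable {n s : ℕ} {G : SimpleGraph (Fin n)} {L : Fin n → Finset (Fin s)} {h : Store} {W : ℕ}

theorem mul_add_injective {a b c d k : ℕ} (hb : b < k) (hd : d < k)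
    (e : a * k + b = c * k + d) : a = c ∧ b = d := by
  have hac : a = c := by
    rcases lt_trichotomy a c with h | h | h
    · have := mul_add_lt h hb; omega
    · exact h
    · have := mul_add_lt h hd; omega
  subst hac
  omega

open Classical in
theorem listColoringInput_adj (G : SimpleGraph (Fin n)) (L : Fin n → Finset (Fin s))
    (u v : Fin n) : (listColoringInput G L).mem (2 + u * n + v) = if G.Adj u v then 1 else 0 := by
  have hlt := mul_add_lt u.isLt v.isLt
  have h1 : (∃ u' v' : Fin n, 2 + (u : ℕ) * n + v = 2 + u' * n + v' ∧ G.Adj u' v') ↔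
      G.Adj u v := by
    refine ⟨?_, fun h => ⟨u, v, rfl, h⟩⟩
    rintro ⟨u', v', e, h⟩
    obtain ⟨e1, e2⟩ := mul_add_injective v.isLt v'.isLt
      (show (u : ℕ) * n + v = u' * n + v' by omega)
    rwa [Fin.ext e1, Fin.ext e2]
  have h2 : ¬ ∃ (v' : Fin n) (i : Fin s), 2 + (u : ℕ) * n + v = 2 + n * n + v' * s + i ∧
      i ∈ L v' := by
    rintro ⟨v', i, e, -⟩
    omega
  simp only [listColoringInput, h1, h2, if_false]
  rw [if_neg (by omega), if_neg (by omega)]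

open Classical in
theorem listColoringInput_list (G : SimpleGraph (Fin n)) (L : Fin n → Finset (Fin s))
    (v : Fin n) (i : Fin s) :
    (listColoringInput G L).mem (2 + n * n + v * s + i) = if i ∈ L v then 1 else 0 := by
  have h1 : ¬ ∃ u' v' : Fin n, 2 + n * n + (v : ℕ) * s + i = 2 + u' * n + v' ∧ G.Adj u' v' := by
    rintro ⟨u', v', e, -⟩
    have := mul_add_lt u'.isLt v'.isLt
    omega
  have h2 : (∃ (v' : Fin n) (i' : Fin s), 2 + n * n + (v : ℕ) * s + i = 2 + n * n + v' * s + i' ∧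
      i' ∈ L v') ↔ i ∈ L v := by
    refine ⟨?_, fun h => ⟨v, i, rfl, h⟩⟩
    rintro ⟨v', i', e, h⟩
    obtain ⟨e1, e2⟩ := mul_add_injective i.isLt i'.isLt
      (show (v : ℕ) * s + i = v' * s + i' by omega)
    rwa [Fin.ext e1, Fin.ext e2]
  simp only [listColoringInput, h1, h2, if_false]
  rw [if_neg (by omega), if_neg (by omega)]

theorem listColoringInput_eq_zero (G : SimpleGraph (Fin n)) (L : Fin n → Finset (Fin s)) {a : ℕ}
    (ha : inputSize n s ≤ a) : (listColoringInput G L).mem a = 0 := by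
  dsimp only [inputSize] at ha
  have h1 : ¬ ∃ u' v' : Fin n, a = 2 + u' * n + v' ∧ G.Adj u' v' := by
    rintro ⟨u', v', e, -⟩
    have := mul_add_lt u'.isLt v'.isLt
    omega
  have h2 : ¬ ∃ (v' : Fin n) (i : Fin s), a = 2 + n * n + v' * s + i ∧ i ∈ L v' := by
    rintro ⟨v', i, e, -⟩
    have := mul_add_lt v'.isLt i.isLt
    omega
  simp only [listColoringInput, h1, h2, if_false]
  rw [if_neg (by omega), if_neg (by omega)]

/-- Read `n` and `s` and compute the size of the input. -/
def loadParams : Prog :=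
  .seq (.const (tmp 0) 0) <| .seq (.load 2 (tmp 0)) <|
  .seq (.const (tmp 0) 1) <| .seq (.load 4 (tmp 0)) <|
  .seq (.op .mul (tmp 0) 2 2) <| .seq (.op .mul 1 2 4) <| .seq (.op .add 1 (tmp 0) 1) <|
  .seq (.const (tmp 0) 2) <| .op .add 1 (tmp 0) 1

/-- The abstract state after `loadParams`. -/
noncomputable def initialStore (G : SimpleGraph (Fin n)) (L : Fin n → Finset (Fin s)) : Store where
  var x := if x = .n then n else if x = .s then s else 0
  arr _ _ := 0
  inp := (listColoringInput G L).mem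

/-- Plain instructions are used because the base register is not yet set. Registers `2` and `4`
belong to the variables `n` and `s`; register `1` receives the base address. -/
theorem exec_loadParams (hW : Fits n s W) (G : SimpleGraph (Fin n)) (L : Fin n → Finset (Fin s)) :
    ∃ σ, Exec W loadParams (listColoringInput G L) 9 σ ∧
      Rep (inputSize n s) (initialStore G L) σ := by
  unfold Fits at hW
  have m0 : (listColoringInput G L).mem 0 = n := by simp [listColoringInput]
  have m1 : (listColoringInput G L).mem 1 = s := by simp [listColoringInput]
  have r0 : ∀ x, (listColoringInput G L).reg x = 0 := fun x => rfl
  refine ⟨_, .seq (.const _ _ _ (by omega)) <| .seq (.load _ _ _) <|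
    .seq (.const _ _ _ (by omega)) <| .seq (.load _ _ _) <| .seq (.op _ _ _ _ _ ?_) <|
    .seq (.op _ _ _ _ _ ?_) <| .seq (.op _ _ _ _ _ ?_) <| .seq (.const _ _ _ (by omega)) <|
    .op _ _ _ _ _ ?_, ?_, ?_, ?_, ?_⟩
  · simp [State.setReg, tmp, Op.eval, m0]; omega
  · simp [State.setReg, tmp, Op.eval, m0, m1]; omega
  · simp [State.setReg, tmp, Op.eval, m0, m1]; omega
  · simp [State.setReg, tmp, Op.eval, m0, m1]; omega
  · intro x
    cases x <;> simp [State.setReg, tmp, Op.eval, m0, m1, r0, Var.idx, initialStore]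
  · simp [State.setReg, tmp, Op.eval, m0, m1, inputSize]; omega
  · exact fun i _ => rfl
  · exact fun a i => listColoringInput_eq_zero G L (by omega)

/-- Compute `n ^ 2` and `n ^ s`. -/
def computeParams : Prog :=
  .seq (assign .sq (Var.n * Var.n)) <| .seq (assign .pw 1) <|
    forLoop .i .s (assign .pw (Var.pw * Var.n))

theorem runs_computeParams (hn : 1 ≤ n) (hW : Fits n s W) (G : SimpleGraph (Fin n))
    (L : Fin n → Finset (Fin s)) :
    Runs W (inputSize n s) computeParams (s * 12 + 12) (Env G L) (initialStore G L) := by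
  obtain ⟨w1, w2, w3, w4, w5⟩ := hW.table hn
  unfold Fits at hW
  have vn : (initialStore G L).var .n = n := by simp [initialStore]
  have vs : (initialStore G L).var .s = s := by simp [initialStore]
  refine Runs.weaken (T := 4 + (2 + (s * (4 + 8) + 6))) (Runs.seq (Runs.assign ?_ ?_)) (by omega)
  · simp [vn]; omega
  refine Runs.seq (Runs.assign (by simp; omega) ?_)
  refine Runs.forLoop s (fun i h => h.var .i = i ∧ h.var .s = s ∧ h.var .n = n ∧
    h.var .sq = n * n ∧ h.var .pw = n ^ i ∧ h.inp = (listColoringInput G L).mem) w5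
    (fun i h hI => ⟨hI.1, hI.2.1⟩)
    ⟨by simp, by simp [vs], by simp [vn], by simp [vn], by simp, rfl⟩ ?_ ?_
  · rintro i hi h ⟨hi', hs', hn', hsq, hpw, hinp⟩
    have : n ^ i * n ≤ n ^ s := by rw [← pow_succ]; exact Nat.pow_le_pow_right hn hi
    refine Runs.assign (by simp [hpw, hn']; omega) ⟨by simpa using hi', by simp, by simpa using hs',
      by simpa using hn', by simpa using hsq, by simp [hpw, hn', pow_succ], hinp⟩
  · rintro h ⟨-, hs', hn', hsq, hpw, hinp⟩
    refine ⟨hn', hs', hsq, hpw, ?_, ?_⟩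
    · rw [hinp]; exact listColoringInput_adj G L
    · rw [hinp]; exact listColoringInput_list G L

/-- The list coloring program. -/
def listColoringProg : Prog :=
  .seq loadParams <| .seq computeParams <| .seq initLabels <| .seq relaxAll <|
    .seq computeDegrees <| .seq computeOrder solveOrdered

/-- The sum in `hT` lists the costs of the phases in the order of execution, beginning with 9 for
`loadParams`. -/
theorem solvesListColoringWithin_of_fits (hn : 1 ≤ n) (hs : 1 ≤ s) (hW : Fits n s W)
    (hT : 9 + ((s * 12 + 12) + ((n * n * 16 + 6) +
      ((n * n * (n * (n * (n * 208 + 6 + 8) + 6 + 8) + 6 + 8) + 6) +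
      ((n * (n * 60 + 40) + 6) + ((n * (n * 60 + 40) + 6) +
      (n ^ s * 30 + n * (n ^ s * (s * 150 + 60) + 40) + n * (s * 150 + 80) + 60)))))) ≤ W)
    (G : SimpleGraph (Fin n)) (L : Fin n → Finset (Fin s)) (hG : IsCoComparabilityGraph G) :
    SolvesListColoringWithin listColoringProg W G L := by
  obtain ⟨σ, e, hσ⟩ := exec_loadParams hW G L
  have main := Runs.seq ((runs_computeParams hn hW G L).mono le_rfl fun h₁ E₁ =>
    Runs.seq ((runs_initLabels hW E₁).mono le_rfl fun h₂ ⟨E₂, A₂⟩ =>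
    Runs.seq ((runs_relaxAll hW E₂ A₂).mono le_rfl fun h₃ ⟨E₃, A₃⟩ =>
    Runs.seq ((runs_computeDegrees hW E₃ A₃).mono le_rfl fun h₄ ⟨E₄, A₄⟩ =>
    Runs.seq ((runs_computeOrder hW E₄ (lexDeg G (labels n h₃))
        (fun v => (Finset.card_le_univ _).trans (by simp)) A₄).mono le_rfl fun h₅ ⟨E₅, A₅⟩ =>
      runs_solveOrdered hn hs hW ⟨E₅, A₅⟩ (isComparabilityOrdering_sortEquiv hG A₃))))))
  obtain ⟨t, σ', h', e', ht, hσ', hQ⟩ := main σ hσ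
  refine ⟨9 + t, σ', e.seq e', by omega, ?_⟩
  have hr : σ'.reg 0 = h'.var .ans := hσ'.var .ans
  rw [IsListColoringAnswer, hr]
  refine hQ.imp id fun ⟨h1, c, hc, ho⟩ => ⟨h1, c, hc, fun v => ?_⟩
  rw [hσ'.inp v, ho v]
  have := Nat.le_mul_of_pos_left n (show 0 < n by omega)
  dsimp only [inputSize]
  omega

theorem solvesListColoringWithin_listColoringProg (hn : 1 ≤ n) (hs : 2 ≤ s)
    (G : SimpleGraph (Fin n)) (L : Fin n → Finset (Fin s)) (hG : IsCoComparabilityGraph G) :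
    SolvesListColoringWithin listColoringProg (2000 * (n ^ (s ^ 2 + 1) * s ^ 3)) G L := by
  -- The cost of the ordering is absorbed because `s ≥ 2` gives `5 ≤ s ^ 2 + 1`. Every other term of
  -- the time bound and of `Fits` is at most a multiple of `n ^ 5` or of `n ^ s * n * s`, and the
  -- coefficients add up to less than 2000.
  have h5 : n ^ 5 ≤ n ^ (s ^ 2 + 1) * s ^ 3 := by
    have : 5 ≤ s ^ 2 + 1 := by nlinarith
    calc n ^ 5 ≤ n ^ (s ^ 2 + 1) := Nat.pow_le_pow_right hn this
      _ ≤ _ := Nat.le_mul_of_pos_right _ (by positivity)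
  have hsn : n ^ s * n * s ≤ n ^ (s ^ 2 + 1) * s ^ 3 := by
    rw [← pow_succ]
    exact Nat.mul_le_mul (Nat.pow_le_pow_right hn (by nlinarith)) (Nat.le_self_pow (by omega) s)
  have p1 : 1 ≤ n ^ s := Nat.one_le_pow _ _ hn
  have q1 : n ^ s ≤ n ^ s * n := Nat.le_mul_of_pos_right _ hn
  have q2 : n ^ s * n ≤ n ^ s * n * s := Nat.le_mul_of_pos_right _ (by omega)
  have q3 : n * s ≤ n ^ s * n * s := by
    rw [mul_assoc]; exact Nat.le_mul_of_pos_left _ p1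
  have q4 : s ≤ n * s := Nat.le_mul_of_pos_left _ hn
  have n1 : n ^ 1 ≤ n ^ 5 := Nat.pow_le_pow_right hn (by omega)
  have n2 : n ^ 2 ≤ n ^ 5 := Nat.pow_le_pow_right hn (by omega)
  have n3 : n ^ 3 ≤ n ^ 5 := Nat.pow_le_pow_right hn (by omega)
  have n4 : n ^ 4 ≤ n ^ 5 := Nat.pow_le_pow_right hn (by omega)
  generalize n ^ (s ^ 2 + 1) * s ^ 3 = X at *
  refine solvesListColoringWithin_of_fits hn (by omega) ?_ ?_ G L hG
  · unfold Fits
    generalize n ^ s = M at *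
    nlinarith
  · generalize n ^ s = M at *
    nlinarith

end RAM

theorem mainTheorem3 :
    ∃ P : RAM.Prog,
      (∃ K : ℕ, ∀ n s : ℕ, 1 ≤ n → 2 ≤ s →
        ∀ (G : SimpleGraph (Fin n)) (L : Fin n → Finset (Fin s)), IsCoComparabilityGraph G →
          SolvesListColoringWithin P (K * (n ^ (s ^ 2 + 1) * s ^ 3)) G L) ∧
      (∀ s : ℕ, 2 ≤ s → ∃ p : Polynomial ℕ, ∀ n : ℕ, 1 ≤ n →
        ∀ (G : SimpleGraph (Fin n)) (L : Fin n → Finset (Fin s)), IsCoComparabilityGraph G →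
          SolvesListColoringWithin P (p.eval n) G L) := by
  refine ⟨RAM.listColoringProg, ⟨2000, fun n s hn hs G L hG =>
    RAM.solvesListColoringWithin_listColoringProg hn hs G L hG⟩, fun s hs =>
    ⟨Polynomial.C 2000 * (Polynomial.X ^ (s ^ 2 + 1) * Polynomial.C (s ^ 3)),
      fun n hn G L hG => ?_⟩⟩
  rw [Polynomial.eval_mul, Polynomial.eval_mul, Polynomial.eval_C, Polynomial.eval_C,
    Polynomial.eval_pow, Polynomial.eval_X]
  exact RAM.solvesListColoringWithin_listColoringProg hn hs G L hG
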